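/- **Model.** Let $Q,\sigma,\delta t,\gamma>0$, let $N$ be a positive integer and let $\mathcal N\subset\{1,\dots,N-1\}$ be non-empty. Let $(\Omega,(\mathcal F_n)_{0\le n\le N},\mathbb P)$ be a filtered probability space, and let $\epsilon_1,\dots,\epsilon_N$ be i.i.d. random variables with mean $0$, variance $1$ and $\mathbb E[e^{t\epsilon_1}]<\infty$ for all $t\ge0$, where $\epsilon_{n+1}$ is $\mathcal F_{n+1}$-measurable and independent of $\mathcal F_n$. Let the market volumes $V_1,\dots,V_N$ be $\mathcal F_0$-measurable and almost surely equal to positive constants (the constancy is automatic if $\mathcal F_0$ is trivial). Let $L\in C(\mathbb R,\mathbb R_+)$ be even, strictly convex, increasing on $\mathbb R_+$, with $L(0)=0$ and $L(\rho)/\rho\to+\infty$ as $\rho\to+\infty$. Let $\ell:\mathbb R\to[0,+\infty]$ be convex, lower semicontinuous (automatic if $\ell$ is finite), even, increasing on $\mathbb R_+$, with $\ell(0)=0$. For $1\le n\le N$, let $\mathcal A_n$ be the set of pairs $(v,n^\star)$ where $v=(v_k)_{n\le k\le n^\star-1}$ is a real-valued adapted process and $n^\star$ is a stopping time with values in $(\mathcal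 N\cup\{N\})\cap\{n,\dots,N\}$. For $n\le k\le N$ set $$q_k=q-\sum_{j=n}^{k-1}v_j\,\delta t,\qquad S_k=S+\sigma\sqrt{\delta t}\sum_{j=n}^{k-1}\epsilon_{j+1},\qquad A_k=\frac nk A+\frac1k\sum_{j=n}^{k-1}S_{j+1},$$ $$X_k=x+\sum_{j=n}^{k-1}\Big(v_jS_{j+1}\delta t+L\Big(\frac{v_j}{V_{j+1}}\Big)V_{j+1}\delta t\Big).$$ All expectations below are of random variables of constant sign, and they and the functions $u_n,\theta_n,\tilde\theta_{n,n+1}$ take values in $[-\infty,+\infty]$, with $\exp(-\infty)=0$, $\exp(+\infty)=+\infty$ and correspondingly for $\log$. For $x,q,S,A,Z\in\mathbb R$ define $$u_n(x,q,S,A)=\sup_{(v,n^\star)\in\mathcal A_n}\mathbb E\Big[-\exp\Big(-\gamma\big(QA_{n^\star}-X_{n^\star}-q_{n^\star}S_{n^\star}-\ell(q_{n^\star})\big)\Big)\Big],$$ $$\theta_n(q,Z)=\inf_{(v,n^\star)\in\mathcal A_n}\frac1\gamma\log\mathbb E\Big[\exp\Big(\gamma\Big(\sigma\sqrt{\delta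 t}\Big(\sum_{j=n}^{n^\star-1}\Big(q_j-\Big(1-\frac j{n^\star}\Big)Q\Big)\epsilon_{j+1}-\Big(1-\frac n{n^\star}\Big)QZ\Big)+\sum_{j=n}^{n^\star-1}L\Big(\frac{v_j}{V_{j+1}}\Big)V_{j+1}\delta t+\ell(q_{n^\star})\Big)\Big)\Big],$$ and, for $n<N$, $$\tilde\theta_{n,n+1}(q,Z)=\inf_{v\in\mathbb R}\frac1\gamma\log\mathbb E\Big[\exp\Big(\gamma\Big(\sigma\sqrt{\delta t}\Big(\Big(q-\frac Q{n+1}\Big)\epsilon_{n+1}-\frac Q{n+1}Z\Big)+L\Big(\frac v{V_{n+1}}\Big)V_{n+1}\delta t+\theta_{n+1}\Big(q-v\,\delta t,\frac n{n+1}(Z+\epsilon_{n+1})\Big)\Big)\Big)\Big].$$ **Proposition.** For all $1\le n\le N$ and all real $x,q,S,A,Z$: (i) with $Y=-QA+x+qS$, $$u_n(x,q,S,A)=-\exp\Big(-\gamma\Big(-Y-\theta_n\Big(q,\frac{S-A}{\sigma\sqrt{\delta t}}\Big)\Big)\Big);$$ (ii) $\theta_n$ satisfies the Bellman equation $$\theta_n(q,Z)=\begin{cases}\ell(q)&\text{if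 }n=N,\\ \min\{\tilde\theta_{n,n+1}(q,Z),\ell(q)\}&\text{if }n\in\mathcal N,\\ \tilde\theta_{n,n+1}(q,Z)&\text{otherwise.}\end{cases}$$ Moreover $\theta_n(q,Z)>-\infty$, and if $\mathbb E[e^{t\epsilon_1}]<\infty$ for all $t\in\mathbb R$, then $\theta_n(q,Z)<+\infty$ for $n<N$. -/

import Mathlib

open MeasureTheory ProbabilityTheory Filter Set
open scoped ENNReal NNReal

namespace ASR

/-- The data of the accelerated share repurchase model with temporary market impact only.
Only the times `0, …, N` of the filtration, and the indices `1, …, N` of `ε` and `V`, matter. -/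
structure Model (Ω : Type*) [mΩ : MeasurableSpace Ω] where
  /-- the probability measure -/
  P : Measure Ω
  /-- the filtration -/
  ℱ : Filtration ℕ mΩ
  /-- number of periods -/
  N : ℕ
  /-- dates, before the terminal date `N`, at which the bank may choose to deliver -/
  𝒩 : Finset ℕ
  /-- number of shares to be delivered -/
  Q : ℝ
  /-- volatility parameter -/
  σ : ℝ
  /-- length of a period -/
  δt : ℝ
  /-- absolute risk aversion -/
  γ : ℝ
  /-- price innovations -/
  ε : ℕ → Ω → ℝ
  /-- market volumes -/
  V : ℕ → Ω → ℝ
  /-- execution cost function -/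
  L : ℝ → ℝ
  /-- penalty function at delivery; the value `∞` is allowed, so that a convex indicator fits -/
  ℓ : ℝ → ℝ≥0∞

namespace Model

variable {Ω : Type*} [mΩ : MeasurableSpace Ω]

/-- The standing assumptions of the model. -/
structure StandingAssumptions (M : Model Ω) : Prop where
  isProbabilityMeasure : IsProbabilityMeasure M.P
  Q_pos : 0 < M.Q
  σ_pos : 0 < M.σ
  δt_pos : 0 < M.δt
  γ_pos : 0 < M.γ
  dates_nonempty : M.𝒩.Nonempty
  dates_subset : ∀ n ∈ M.𝒩, 1 ≤ n ∧ n < M.N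
  /- The innovations are adapted, each is independent of the past (hence they are mutually
  independent), and they are identically distributed, centred, of variance one, with a
  moment-generating function that is finite on the nonnegative half-line. -/
  ε_measurable : ∀ k, 1 ≤ k → k ≤ M.N → Measurable[M.ℱ k] (M.ε k)
  ε_indep : ∀ k, k < M.N →
    Indep (MeasurableSpace.comap (M.ε (k + 1)) inferInstance) (M.ℱ k) M.P
  ε_identDistrib : ∀ k, 1 ≤ k → k ≤ M.N → IdentDistrib (M.ε k) (M.ε 1) M.P M.P
  ε_memLp : MemLp (M.ε 1) 2 M.P
  ε_mean : ∫ ω, M.ε 1 ω ∂M.P = 0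
  ε_variance : variance (M.ε 1) M.P = 1
  ε_mgf : ∀ t : ℝ, 0 ≤ t → Integrable (fun ω => Real.exp (t * M.ε 1 ω)) M.P
  /- The market volumes are known at time `0`: they are `ℱ 0`-measurable and almost surely equal
  to positive constants (the latter is automatic for positive volumes if `ℱ 0` is trivial). -/
  V_measurable : ∀ k, 1 ≤ k → k ≤ M.N → Measurable[M.ℱ 0] (M.V k)
  V_const : ∀ k, 1 ≤ k → k ≤ M.N → ∃ c : ℝ, 0 < c ∧ ∀ᵐ ω ∂M.P, M.V k ω = c
  L_continuous : Continuous M.L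
  L_nonneg : ∀ ρ, 0 ≤ M.L ρ
  L_zero : M.L 0 = 0
  L_even : ∀ ρ, M.L (-ρ) = M.L ρ
  L_mono : MonotoneOn M.L (Ici 0)
  L_strictConvex : StrictConvexOn ℝ univ M.L
  L_superlinear : Tendsto (fun ρ => M.L ρ / ρ) atTop atTop
  ℓ_zero : M.ℓ 0 = 0
  ℓ_even : ∀ q, M.ℓ (-q) = M.ℓ q
  ℓ_mono : MonotoneOn M.ℓ (Ici 0)
  ℓ_convex : ConvexOn ℝ≥0 univ M.ℓ
  /- Automatic if `ℓ` takes finite values only. -/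
  ℓ_lsc : LowerSemicontinuous M.ℓ

/-- Admissible strategies from time `n` on: an adapted trading rate `v` and a stopping time `τ`
(the time of delivery) with values in `(𝒩 ∪ {N}) ∩ {n, …, N}`. Only the values of `v k` for
`n ≤ k < τ` are ever used. -/
structure Strategy (M : Model Ω) (n : ℕ) where
  v : ℕ → Ω → ℝ
  τ : Ω → ℕ
  adapted : ∀ k, n ≤ k → k < M.N → Measurable[M.ℱ k] (v k)
  isStoppingTime : IsStoppingTime M.ℱ (fun ω => (τ ω : WithTop ℕ))
  mem_dates : ∀ ω, τ ω ∈ insert M.N M.𝒩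
  le_τ : ∀ ω, n ≤ τ ω

variable (M : Model Ω)

/-- Number of shares that remain to be bought at time `k`, starting from `q` at time `n`. -/
noncomputable def inventory (n : ℕ) (q : ℝ) (v : ℕ → Ω → ℝ) (k : ℕ) (ω : Ω) : ℝ :=
  q - ∑ j ∈ Finset.Ico n k, v j ω * M.δt

/-- Price at time `k`, starting from `S` at time `n`. -/
noncomputable def price (n : ℕ) (S : ℝ) (k : ℕ) (ω : Ω) : ℝ :=
  S + M.σ * √M.δt * ∑ j ∈ Finset.Ico n k, M.ε (j + 1) ω

/-- Average price at time `k`, starting from the price `S` and the average `A` at time `n`. -/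
noncomputable def average (n : ℕ) (A S : ℝ) (k : ℕ) (ω : Ω) : ℝ :=
  (n : ℝ) / k * A + 1 / (k : ℝ) * ∑ j ∈ Finset.Ico n k, M.price n S (j + 1) ω

/-- Execution costs paid between times `n` and `k`. -/
noncomputable def execCost (n : ℕ) (v : ℕ → Ω → ℝ) (k : ℕ) (ω : Ω) : ℝ :=
  ∑ j ∈ Finset.Ico n k, M.L (v j ω / M.V (j + 1) ω) * M.V (j + 1) ω * M.δt

/-- Cash spent up to time `k`, starting from `x` at time `n`. -/
noncomputable def cash (n : ℕ) (x S : ℝ) (v : ℕ → Ω → ℝ) (k : ℕ) (ω : Ω) : ℝ :=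
  x + (∑ j ∈ Finset.Ico n k, v j ω * M.price n S (j + 1) ω * M.δt) + M.execCost n v k ω

/-- The value function. The expectation of the nonpositive random variable `-exp (-γ W)` is
minus the Lebesgue integral of `exp (-γ W)`, an element of `[-∞, 0]`. -/
noncomputable def u (n : ℕ) (x q S A : ℝ) : EReal :=
  ⨆ s : M.Strategy n,
    -((∫⁻ ω, EReal.exp (-(M.γ : EReal) *
        (((M.Q * M.average n A S (s.τ ω) ω - M.cash n x S s.v (s.τ ω) ω
            - M.inventory n q s.v (s.τ ω) ω * M.price n S (s.τ ω) ω : ℝ) : EReal)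
          - (M.ℓ (M.inventory n q s.v (s.τ ω) ω) : EReal))) ∂M.P : ℝ≥0∞) : EReal)

/-- The reduced value function, an infimum over strategies of a log-exponential cost. -/
noncomputable def θ (n : ℕ) (q Z : ℝ) : EReal :=
  ⨅ s : M.Strategy n, ((1 / M.γ : ℝ) : EReal) * ENNReal.log
    (∫⁻ ω, EReal.exp ((M.γ : EReal) *
      (((M.σ * √M.δt *
            ((∑ j ∈ Finset.Ico n (s.τ ω),
                (M.inventory n q s.v j ω - (1 - (j : ℝ) / s.τ ω) * M.Q) * M.ε (j + 1) ω)
              - (1 - (n : ℝ) / s.τ ω) * M.Q * Z)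
          + M.execCost n s.v (s.τ ω) ω : ℝ) : EReal)
        + (M.ℓ (M.inventory n q s.v (s.τ ω) ω) : EReal))) ∂M.P)

/-- The one-step continuation value: trade at a constant rate `v` over one period and then
proceed with the reduced value function at time `n + 1`. -/
noncomputable def θtilde (n : ℕ) (q Z : ℝ) : EReal :=
  ⨅ v : ℝ, ((1 / M.γ : ℝ) : EReal) * ENNReal.log
    (∫⁻ ω, EReal.exp ((M.γ : EReal) *
      (((M.σ * √M.δt *
            ((q - M.Q / (n + 1)) * M.ε (n + 1) ω - M.Q / (n + 1) * Z)
          + M.L (v / M.V (n + 1) ω) * M.V (n + 1) ω * M.δt : ℝ) : EReal)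
        + M.θ (n + 1) (q - v * M.δt) ((n : ℝ) / (n + 1) * (Z + M.ε (n + 1) ω)))) ∂M.P)

end Model

end ASR

/-! Everything is proved on the exponential scale, in `ℝ≥0∞`: `x ↦ (1/γ) log x` is an order
isomorphism onto `EReal`, so it commutes with infima and minima, and infinite penalties need no
separate treatment.

Two identities reduce the dimension. By summation by parts, cash plus the value of the shares still
to be bought changes only through inventory times innovation and through execution costs; this
isolates `Y` and leaves the exponent of `θ` (`neg_payoff_eq`). The weights `1 - j/n⋆` in that
exponent anticipate the delivery date. Along the normalised spread between price and average, a
telescoping sum turns it into a sum of step costs that depend only on the current `(q, Z)`, the rate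
and the next innovation (`runningCost_eq`). What remains is a Markovian control and stopping
problem.

Its dynamic programming solution `dp` is identified with the value by verification: `dp` is below
the cost of every strategy (`dp_le_reducedCost`), and a feedback strategy attains it
(`exists_reducedCost_eq_dp`). The feedback needs a measurable minimising rate. Backward induction
(`dp_regular`) shows that `dp` is lower semicontinuous and has an exponential lower bound uniform in
`q`: by Jensen, the term linear in the centred innovation disappears, while the growth of `L` makes
the problem coercive in the rate. The smallest minimiser is then measurable. The lower bound also
gives `θ > -∞`; clearing the inventory in one period and then not trading gives `θ < +∞`. -/

namespace ASR

open scoped Topology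

/-! ### Lower semicontinuous parametric minimisation and measurable selection. -/

section Semicontinuity

/-- Fatou's lemma along the neighbourhood filter, which first countability makes countably
generated. -/
theorem lowerSemicontinuous_lintegral {X α : Type*} [TopologicalSpace X]
    [FirstCountableTopology X] [MeasurableSpace α] (μ : Measure α) {f : X → α → ℝ≥0∞}
    (hm : ∀ x, Measurable (f x)) (hf : ∀ a, LowerSemicontinuous fun x => f x a) :
    LowerSemicontinuous fun x => ∫⁻ a, f x a ∂μ := by
  rw [lowerSemicontinuous_iff_le_liminf]
  intro x
  calc ∫⁻ a, f x a ∂μ ≤ ∫⁻ a, liminf (fun y => f y a) (𝓝 x) ∂μ :=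
        lintegral_mono fun a => (hf a).le_liminf x
    _ ≤ _ := lintegral_liminf_le hm

theorem lowerSemicontinuous_mul {X : Type*} [TopologicalSpace X] {f g : X → ℝ≥0∞}
    (hf : LowerSemicontinuous f) (hg : LowerSemicontinuous g) :
    LowerSemicontinuous fun x => f x * g x := by
  rw [lowerSemicontinuous_iff_le_liminf]
  intro x
  exact (mul_le_mul' (hf.le_liminf x) (hg.le_liminf x)).trans ENNReal.le_liminf_mul

/-- Finite sublevels of `F x` are bounded, locally uniformly in `x`. -/
def LocallyCoercive {X : Type*} [PseudoMetricSpace X] (F : X → ℝ → ℝ≥0∞) : Prop :=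
  ∀ (x₀ : X) (R : ℝ) (a : ℝ≥0∞), a ≠ ∞ →
    ∃ B : ℝ, ∀ x, dist x x₀ ≤ R → ∀ v, F x v ≤ a → |v| ≤ B

variable {X : Type*} [PseudoMetricSpace X] {F : X → ℝ → ℝ≥0∞}

/-- Coercivity near `x₀` confines the `v n` to a compact interval, and semicontinuity passes the
bound to a subsequential limit. Both attainment and semicontinuity of the infimum follow from this.
The closed set `C` is kept general because the measurable selection minimises over half-lines. -/
theorem LocallyCoercive.exists_le_of_tendsto (hc : LocallyCoercive F)
    (hF : LowerSemicontinuous fun p : X × ℝ => F p.1 p.2) {C : Set ℝ} (hC : IsClosed C)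
    {x : ℕ → X} {x₀ : X} (hx : Tendsto x atTop (𝓝 x₀)) {v : ℕ → ℝ} (hv : ∀ n, v n ∈ C)
    {b : ℕ → ℝ≥0∞} {a : ℝ≥0∞} (hb : Tendsto b atTop (𝓝 a)) (ha : a ≠ ∞)
    (hle : ∀ n, F (x n) (v n) ≤ b n) : ∃ w ∈ C, F x₀ w ≤ a := by
  obtain ⟨B, hB⟩ := hc x₀ 1 (a + 1) (by simp [ha])
  have h1 : ∀ᶠ n in atTop, |v n| ≤ B := by
    have hd : ∀ᶠ n in atTop, dist (x n) x₀ < 1 := hx (Metric.ball_mem_nhds x₀ one_pos)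
    have hb' : ∀ᶠ n in atTop, b n < a + 1 :=
      hb.eventually_lt_const (ENNReal.lt_add_right ha one_ne_zero)
    filter_upwards [hd, hb'] with n h1 h2 using hB _ h1.le _ ((hle n).trans h2.le)
  obtain ⟨w, -, φ, hφ, hw⟩ := (isCompact_Icc (a := -B) (b := B)).tendsto_subseq'
    (h1.mono fun n hn => abs_le.1 hn).frequently
  refine ⟨w, hC.mem_of_tendsto hw (Eventually.of_forall fun n => hv _), ?_⟩
  have ht : Tendsto (fun n => (x (φ n), v (φ n))) atTop (𝓝 (x₀, w)) :=
    (hx.comp hφ.tendsto_atTop).prodMk_nhds hw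
  refine le_of_forall_lt fun y hy => ?_
  obtain ⟨y', hy1, hy2⟩ := exists_between hy
  have h2 : ∀ᶠ n in atTop, y' < F (x (φ n)) (v (φ n)) := ht (hF (x₀, w) y' hy2)
  exact hy1.trans_le (ge_of_tendsto (hb.comp hφ.tendsto_atTop)
    (h2.mono fun n hn => hn.le.trans (hle _)))

theorem LocallyCoercive.exists_eq_iInf (hc : LocallyCoercive F)
    (hF : LowerSemicontinuous fun p : X × ℝ => F p.1 p.2) {C : Set ℝ} (hC : IsClosed C)
    (x : X) (hx : (⨅ v ∈ C, F x v) ≠ ∞) : ∃ v ∈ C, F x v = ⨅ v ∈ C, F x v := by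
  set a := ⨅ v ∈ C, F x v with ha
  have h1 : ∀ n : ℕ, ∃ v ∈ C, F x v < a + ((n : ℝ≥0∞) + 1)⁻¹ := by
    intro n
    have : a < a + ((n : ℝ≥0∞) + 1)⁻¹ := ENNReal.lt_add_right hx (by simp)
    conv_lhs at this => rw [ha]
    simpa [iInf_lt_iff] using this
  choose v hvC hv using h1
  have ht : Tendsto (fun n : ℕ => a + ((n : ℝ≥0∞) + 1)⁻¹) atTop (𝓝 a) := by
    have : Tendsto (fun n : ℕ => ((n + 1 : ℕ) : ℝ≥0∞)⁻¹) atTop (𝓝 0) :=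
      ENNReal.tendsto_inv_nat_nhds_zero.comp (tendsto_add_atTop_nat 1)
    simpa using this.const_add a
  obtain ⟨w, hw, hle⟩ := hc.exists_le_of_tendsto hF hC tendsto_const_nhds hvC ht hx
    fun n => (hv n).le
  exact ⟨w, hw, le_antisymm hle (iInf₂_le w hw)⟩

theorem LocallyCoercive.lowerSemicontinuous_iInf (hc : LocallyCoercive F)
    (hF : LowerSemicontinuous fun p : X × ℝ => F p.1 p.2) {C : Set ℝ} (hC : IsClosed C) :
    LowerSemicontinuous fun x => ⨅ v ∈ C, F x v := by
  rw [lowerSemicontinuous_iff_isClosed_preimage]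
  intro a
  rcases eq_or_ne a ∞ with rfl | ha
  · simp
  refine IsSeqClosed.isClosed fun x x₀ hx hlim => ?_
  have h1 : ∀ n, ∃ v ∈ C, F (x n) v ≤ a := fun n => by
    have hn : (⨅ v ∈ C, F (x n) v) ≤ a := hx n
    obtain ⟨v, hv, he⟩ := hc.exists_eq_iInf hF hC (x n) (ne_top_of_le_ne_top ha hn)
    exact ⟨v, hv, he.trans_le hn⟩
  choose v hvC hv using h1
  obtain ⟨w, hw, hle⟩ := hc.exists_le_of_tendsto hF hC hlim hvC tendsto_const_nhds ha hv
  exact le_trans (iInf₂_le (f := fun v (_ : v ∈ C) => F x₀ v) w hw) hle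

/-- A lower semicontinuous, locally coercive function has a measurable selection of minimisers:
the smallest one. -/
theorem LocallyCoercive.exists_measurable_argmin [MeasurableSpace X] [BorelSpace X]
    (hc : LocallyCoercive F) (hF : LowerSemicontinuous fun p : X × ℝ => F p.1 p.2) :
    ∃ φ : X → ℝ, Measurable φ ∧ ∀ x, F x (φ x) = ⨅ v, F x v := by
  have hI : ∀ x, (⨅ v ∈ (univ : Set ℝ), F x v) = ⨅ v, F x v := by simp
  have hl : LowerSemicontinuous fun x => ⨅ v, F x v := by
    simpa only [hI] using hc.lowerSemicontinuous_iInf hF isClosed_univ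
  have key : ∀ x, ∃ v, F x v = (⨅ v, F x v) ∧
      ((⨅ v, F x v) ≠ ∞ → ∀ v', F x v' = (⨅ v, F x v) → v ≤ v') ∧
      -- Where the infimum is `∞`, every point is a minimiser and there is no smallest one; `0` is a
      -- measurable default.
      ((⨅ v, F x v) = ∞ → v = 0) := by
    intro x
    by_cases hx : (⨅ v, F x v) = ∞
    · refine ⟨0, ?_, fun h => absurd hx h, fun _ => rfl⟩
      rw [hx, ← top_le_iff, ← hx]
      exact iInf_le _ 0
    obtain ⟨v₀, -, hv₀⟩ := hc.exists_eq_iInf hF isClosed_univ x (by rwa [hI])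
    rw [hI] at hv₀
    have hset : {v | F x v = ⨅ v, F x v} = (fun v => F x v) ⁻¹' Iic (⨅ v, F x v) := by
      ext v
      exact ⟨fun h => le_of_eq h, fun h => le_antisymm h (iInf_le _ v)⟩
    have hcl : IsClosed {v | F x v = ⨅ v, F x v} := by
      rw [hset]
      exact (hF.comp (Continuous.prodMk_right x)).isClosed_preimage _
    obtain ⟨B, hB⟩ := hc x 0 _ hx
    have hbd : BddBelow {v | F x v = ⨅ v, F x v} :=
      ⟨-B, fun v hv => (abs_le.1 (hB x (by simp) v (le_of_eq hv))).1⟩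
    exact ⟨_, hcl.csInf_mem ⟨v₀, hv₀⟩ hbd, fun _ v' hv' => csInf_le hbd hv', fun h => absurd h hx⟩
  choose φ h1 h2 h3 using key
  refine ⟨φ, measurable_of_Iic fun t => ?_, h1⟩
  -- The smallest minimiser is at most `t` exactly when minimising over `Iic t` already reaches the
  -- global infimum. This compares two lower semicontinuous, hence measurable, functions of `x`.
  have : φ ⁻¹' Iic t = ({x | (⨅ v, F x v) = ∞} ∩ {_x | 0 ≤ t}) ∪
      ({x | (⨅ v, F x v) = ∞}ᶜ ∩ {x | (⨅ v ∈ Iic t, F x v) ≤ ⨅ v, F x v}) := by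
    ext x
    by_cases hx : (⨅ v, F x v) = ∞
    · simp only [mem_preimage, mem_Iic, h3 x hx, mem_union, mem_inter_iff, mem_ofPred_eq, hx,
        mem_compl_iff, not_true, true_and, false_and, or_false]
    · simp only [mem_preimage, mem_Iic, mem_union, mem_inter_iff, mem_ofPred_eq, hx, false_and,
        mem_compl_iff, not_false_eq_true, true_and, false_or]
      constructor
      · intro h
        exact (iInf₂_le (φ x) h).trans (h1 x).le
      · intro h
        obtain ⟨v, hv, he⟩ := hc.exists_eq_iInf hF (isClosed_Iic (a := t)) x
          (ne_top_of_le_ne_top hx h)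
        exact (h2 x hx v (le_antisymm (he.trans_le h) (iInf_le _ v))).trans hv
  rw [this]
  have hm := hl.measurable
  have hm' := (hc.lowerSemicontinuous_iInf hF (isClosed_Iic (a := t))).measurable
  have hT : MeasurableSet {x | (⨅ v, F x v) = ∞} := hm (measurableSet_singleton ∞)
  exact (hT.inter (MeasurableSet.const _)).union (hT.compl.inter (measurableSet_le hm' hm))

end Semicontinuity

/-! ### Jensen's inequality and conditioning by freezing. -/

section Probability

/-- Jensen's inequality for the exponential. -/
theorem ofReal_exp_integral_le_lintegral {α : Type*} [MeasurableSpace α] (μ : Measure α)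
    [IsProbabilityMeasure μ] {h : α → ℝ} (hh : Integrable h μ) :
    ENNReal.ofReal (Real.exp (∫ a, h a ∂μ)) ≤ ∫⁻ a, ENNReal.ofReal (Real.exp (h a)) ∂μ := by
  set m := ∫ a, h a ∂μ with hm
  -- The tangent to `exp` at the mean lies below `exp` and integrates to `exp m`. Only the tangent
  -- has to be integrable, so the right-hand side may be infinite.
  have hi : Integrable (fun a => Real.exp m * (1 + (h a - m))) μ :=
    ((integrable_const _).add (hh.sub (integrable_const _))).const_mul _
  have h1 : ∫ a, Real.exp m * (1 + (h a - m)) ∂μ = Real.exp m := by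
    have h2 : ∫ a, (1 + (h a - m)) ∂μ = 1 := by
      have h3 : ∫ a, (h a - m) ∂μ = 0 := by
        rw [integral_sub hh (integrable_const _)]
        simp [← hm]
      rw [integral_add (integrable_const _) (by exact hh.sub (integrable_const _)), h3]
      simp
    rw [integral_const_mul, h2, mul_one]
  rw [← h1]
  have h2 : ENNReal.ofReal (∫ a, Real.exp m * (1 + (h a - m)) ∂μ) ≤
      ∫⁻ a, ENNReal.ofReal (Real.exp m * (1 + (h a - m))) ∂μ := by
    rw [integral_eq_lintegral_pos_part_sub_lintegral_neg_part hi]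
    exact (ENNReal.ofReal_le_ofReal (sub_le_self _ ENNReal.toReal_nonneg)).trans
      ENNReal.ofReal_toReal_le
  refine h2.trans (lintegral_mono fun a => ?_)
  refine ENNReal.ofReal_le_ofReal ?_
  have := Real.add_one_le_exp (h a - m)
  calc Real.exp m * (1 + (h a - m)) ≤ Real.exp m * Real.exp (h a - m) := by gcongr; linarith
    _ = Real.exp (h a) := by rw [← Real.exp_add]; ring_nf

/-- Freezing lemma: integrate out a variable independent of the past. -/
theorem lintegral_eq_lintegral_lintegral_of_indep {Ω E : Type*} {m mΩ : MeasurableSpace Ω}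
    [mE : MeasurableSpace E] {P : Measure Ω} [IsProbabilityMeasure P]
    (hm : m ≤ mΩ) {X : Ω → E} (hX : Measurable[m] X) {ε : Ω → ℝ} (hε : Measurable ε)
    (hind : Indep (MeasurableSpace.comap ε inferInstance) m P) {h : E → ℝ → ℝ≥0∞}
    (hh : Measurable fun p : E × ℝ => h p.1 p.2) :
    ∫⁻ ω, h (X ω) (ε ω) ∂P = ∫⁻ ω, ∫⁻ e, h (X ω) e ∂(P.map ε) ∂P := by
  have hX' : Measurable X := hX.mono hm le_rfl
  have hI : IndepFun X ε P := by
    rw [IndepFun_iff_Indep]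
    exact (indep_of_indep_of_le_right hind hX.comap_le).symm
  have := (indepFun_iff_map_prod_eq_prod_map_map hX'.aemeasurable hε.aemeasurable).1 hI
  have : IsProbabilityMeasure (P.map ε) := Measure.isProbabilityMeasure_map hε.aemeasurable
  rw [← lintegral_map (f := fun p : E × ℝ => h p.1 p.2) (g := fun ω => (X ω, ε ω)) hh
    (hX'.prodMk hε), ‹P.map _ = _›, lintegral_prod _ hh.aemeasurable,
    lintegral_map hh.lintegral_prod_right' hX']

end Probability

end ASR

namespace ASR
open scoped Topology
namespace Model

variable {Ω : Type*} [mΩ : MeasurableSpace Ω]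

/-! ### The dynamic programming recursion and its regularity. -/

section DynamicProgramming

variable (M : Model Ω)

/-- The law of the innovations. -/
noncomputable def innovationLaw : Measure ℝ := M.P.map (M.ε 1)

/-- The almost sure value of the market volume. -/
noncomputable def meanVolume (k : ℕ) : ℝ := ∫ ω, M.V k ω ∂M.P

/-- The cost of trading at rate `v` between times `k` and `k + 1`, for the innovation `e`. -/
noncomputable def stepCost (k : ℕ) (z : ℝ × ℝ) (v e : ℝ) : ℝ :=
  M.σ * √M.δt * ((z.1 - M.Q / (k + 1)) * e - M.Q / (k + 1) * z.2)
    + M.L (v / M.meanVolume (k + 1)) * M.meanVolume (k + 1) * M.δt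

/-- The transition of the reduced state `(q, Z)` between times `k` and `k + 1`. -/
noncomputable def nextState (k : ℕ) (z : ℝ × ℝ) (v e : ℝ) : ℝ × ℝ :=
  (z.1 - v * M.δt, (k : ℝ) / (k + 1) * (z.2 + e))

/-- The exponential of the penalty at delivery. -/
noncomputable def penalty (q : ℝ) : ℝ≥0∞ := EReal.exp ((M.γ : EReal) * (M.ℓ q : EReal))

/-- Expected cost when trading at rate `v` from time `k`, with future cost `w`. -/
noncomputable def continuation (k : ℕ) (w : ℝ × ℝ → ℝ≥0∞) (z : ℝ × ℝ) (v : ℝ) : ℝ≥0∞ :=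
  ∫⁻ e, ENNReal.ofReal (Real.exp (M.γ * M.stepCost k z v e)) * w (M.nextState k z v e)
    ∂M.innovationLaw

/-- The dynamic programming recursion, indexed by the number of remaining periods. -/
noncomputable def dpRemaining : ℕ → ℝ × ℝ → ℝ≥0∞
  | 0 => fun z => M.penalty z.1
  | d + 1 => fun z =>
      if M.N - (d + 1) ∈ M.𝒩 then
        min (⨅ v, M.continuation (M.N - (d + 1)) (dpRemaining d) z v) (M.penalty z.1)
      else ⨅ v, M.continuation (M.N - (d + 1)) (dpRemaining d) z v

/-- The solution of the dynamic programming recursion at time `k`. -/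
noncomputable def dp (k : ℕ) : ℝ × ℝ → ℝ≥0∞ := M.dpRemaining (M.N - k)

theorem dp_terminal (z : ℝ × ℝ) : M.dp M.N z = M.penalty z.1 := by
  simp [dp, dpRemaining]

theorem dp_of_lt {k : ℕ} (hk : k < M.N) (z : ℝ × ℝ) :
    M.dp k z = if k ∈ M.𝒩 then min (⨅ v, M.continuation k (M.dp (k + 1)) z v) (M.penalty z.1)
      else ⨅ v, M.continuation k (M.dp (k + 1)) z v := by
  obtain ⟨d, hd⟩ : ∃ d, M.N - k = d + 1 := ⟨M.N - k - 1, by omega⟩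
  have h1 : M.N - (k + 1) = d := by omega
  have h2 : M.N - (d + 1) = k := by omega
  simp only [dp, hd, h1, dpRemaining, h2]

theorem dp_le_continuation {k : ℕ} (hk : k < M.N) (z : ℝ × ℝ) (v : ℝ) :
    M.dp k z ≤ M.continuation k (M.dp (k + 1)) z v := by
  rw [dp_of_lt M hk]
  split_ifs
  · exact (min_le_left _ _).trans (iInf_le _ v)
  · exact iInf_le _ v

theorem dp_le_penalty {k : ℕ} (hk : k ∈ insert M.N M.𝒩) (hkN : k ≤ M.N) (z : ℝ × ℝ) :
    M.dp k z ≤ M.penalty z.1 := by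
  rcases hkN.eq_or_lt with rfl | hlt
  · exact (M.dp_terminal z).le
  · have hk' : k ∈ M.𝒩 := by
      rcases Finset.mem_insert.1 hk with h | h
      · omega
      · exact h
    rw [dp_of_lt M hlt, if_pos hk']
    exact min_le_right _ _

variable {M} (hM : M.StandingAssumptions)

include hM

theorem StandingAssumptions.measurable_ε {k : ℕ} (h1 : 1 ≤ k) (hk : k ≤ M.N) :
    Measurable (M.ε k) :=
  (hM.ε_measurable k h1 hk).mono (M.ℱ.le k) le_rfl

theorem StandingAssumptions.one_le_N : 1 ≤ M.N := by
  obtain ⟨n, hn⟩ := hM.dates_nonempty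
  have := hM.dates_subset n hn
  omega

theorem StandingAssumptions.map_ε {k : ℕ} (h1 : 1 ≤ k) (hk : k ≤ M.N) :
    M.P.map (M.ε k) = M.innovationLaw :=
  (hM.ε_identDistrib k h1 hk).map_eq

theorem StandingAssumptions.volume_ae_eq {k : ℕ} (h1 : 1 ≤ k) (hk : k ≤ M.N) :
    0 < M.meanVolume k ∧ ∀ᵐ ω ∂M.P, M.V k ω = M.meanVolume k := by
  have := hM.isProbabilityMeasure
  obtain ⟨c, hc, h⟩ := hM.V_const k h1 hk
  have : M.meanVolume k = c := by
    rw [meanVolume, integral_congr_ae h]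
    simp
  rw [this]
  exact ⟨hc, h⟩

theorem StandingAssumptions.isProbabilityMeasure_innovationLaw :
    IsProbabilityMeasure M.innovationLaw :=
  have := hM.isProbabilityMeasure
  Measure.isProbabilityMeasure_map (hM.measurable_ε le_rfl hM.one_le_N).aemeasurable

theorem StandingAssumptions.integrable_id : Integrable (fun e : ℝ => e) M.innovationLaw := by
  have := hM.isProbabilityMeasure
  change Integrable id (M.P.map (M.ε 1))
  rw [integrable_map_measure aestronglyMeasurable_id
    (hM.measurable_ε le_rfl hM.one_le_N).aemeasurable]
  exact hM.ε_memLp.integrable (by norm_num)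

theorem StandingAssumptions.integral_id : ∫ e, e ∂M.innovationLaw = 0 := by
  change ∫ e, id e ∂(M.P.map (M.ε 1)) = 0
  rw [integral_map (hM.measurable_ε le_rfl hM.one_le_N).aemeasurable
    aestronglyMeasurable_id]
  exact hM.ε_mean

theorem StandingAssumptions.one_le_penalty (q : ℝ) : 1 ≤ M.penalty q := by
  rw [penalty, EReal.one_le_exp_iff]
  exact mul_nonneg (by exact_mod_cast hM.γ_pos.le) (EReal.coe_ennreal_nonneg _)

theorem StandingAssumptions.penalty_zero : M.penalty 0 = 1 := by
  simp [penalty, hM.ℓ_zero]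

theorem StandingAssumptions.lowerSemicontinuous_penalty : LowerSemicontinuous M.penalty := by
  have h1 : M.penalty = (fun x : ℝ≥0∞ => (EReal.exp (x : EReal)) ^ M.γ) ∘ M.ℓ := by
    ext q
    simp [penalty, mul_comm (M.γ : EReal), EReal.exp_mul]
  rw [h1]
  refine Continuous.comp_lowerSemicontinuous ?_ hM.ℓ_lsc ?_
  · exact ENNReal.continuous_rpow_const.comp
      (ENNReal.continuous_exp.comp continuous_coe_ennreal_ereal)
  · intro x y hxy
    exact ENNReal.rpow_le_rpow (EReal.exp_monotone (EReal.coe_ennreal_le_coe_ennreal_iff.2 hxy))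
      hM.γ_pos.le

theorem StandingAssumptions.continuous_stepCost (k : ℕ) :
    Continuous fun p : ((ℝ × ℝ) × ℝ) × ℝ => M.stepCost k p.1.1 p.1.2 p.2 := by
  have := hM.L_continuous
  unfold stepCost
  fun_prop

omit hM in
theorem continuous_nextState (k : ℕ) :
    Continuous fun p : ((ℝ × ℝ) × ℝ) × ℝ => M.nextState k p.1.1 p.1.2 p.2 := by
  unfold nextState
  fun_prop

theorem StandingAssumptions.lowerSemicontinuous_integrand {w : ℝ × ℝ → ℝ≥0∞}
    (hw : LowerSemicontinuous w) (k : ℕ) :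
    LowerSemicontinuous fun p : ((ℝ × ℝ) × ℝ) × ℝ =>
      ENNReal.ofReal (Real.exp (M.γ * M.stepCost k p.1.1 p.1.2 p.2)) *
        w (M.nextState k p.1.1 p.1.2 p.2) := by
  refine lowerSemicontinuous_mul (Continuous.lowerSemicontinuous ?_)
    (hw.comp (continuous_nextState k))
  have := hM.continuous_stepCost k
  exact ENNReal.continuous_ofReal.comp (by fun_prop)

theorem StandingAssumptions.measurable_integrand {w : ℝ × ℝ → ℝ≥0∞}
    (hw : LowerSemicontinuous w) (k : ℕ) (z : ℝ × ℝ) (v : ℝ) :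
    Measurable fun e => ENNReal.ofReal (Real.exp (M.γ * M.stepCost k z v e)) *
      w (M.nextState k z v e) :=
  ((hM.lowerSemicontinuous_integrand hw k).comp (g := fun e : ℝ => ((z, v), e))
    (by fun_prop)).measurable

theorem StandingAssumptions.lowerSemicontinuous_continuation {w : ℝ × ℝ → ℝ≥0∞}
    (hw : LowerSemicontinuous w) (k : ℕ) :
    LowerSemicontinuous fun p : (ℝ × ℝ) × ℝ => M.continuation k w p.1 p.2 := by
  have h := hM.lowerSemicontinuous_integrand hw k
  refine lowerSemicontinuous_lintegral (X := (ℝ × ℝ) × ℝ) M.innovationLaw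
    (f := fun p e => ENNReal.ofReal (Real.exp (M.γ * M.stepCost k p.1 p.2 e)) *
      w (M.nextState k p.1 p.2 e)) (fun p => ?_) fun e => ?_
  · exact hM.measurable_integrand hw k p.1 p.2
  · exact h.comp (g := fun p : (ℝ × ℝ) × ℝ => (p, e)) (by fun_prop)

omit hM in
/-- A lower bound for the value function that is uniform in the inventory. -/
def HasExpLowerBound (M : Model Ω) (w : ℝ × ℝ → ℝ≥0∞) : Prop :=
  ∃ a b : ℝ, 0 ≤ a ∧ ∀ z, ENNReal.ofReal (Real.exp (M.γ * (-(a * |z.2|) - b))) ≤ w z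

/-- Jensen's inequality is applied to a minorant of the exponent. The inventory enters it only
through a multiple of the innovation, which has mean zero, so the bound does not depend on `q`. The
execution cost is kept because it supplies coercivity in `v`. -/
theorem StandingAssumptions.exists_le_continuation {w : ℝ × ℝ → ℝ≥0∞}
    (hw : M.HasExpLowerBound w) (k : ℕ) :
    ∃ a b : ℝ, 0 ≤ a ∧ ∀ z v, ENNReal.ofReal (Real.exp (M.γ *
      (M.L (v / M.meanVolume (k + 1)) * M.meanVolume (k + 1) * M.δt - a * |z.2| - b))) ≤
        M.continuation k w z v := by
  have := hM.isProbabilityMeasure_innovationLaw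
  obtain ⟨a, b, ha, hab⟩ := hw
  have hγ := hM.γ_pos
  have hQ := hM.Q_pos
  have hc : 0 ≤ M.σ * √M.δt := mul_nonneg hM.σ_pos.le (Real.sqrt_nonneg _)
  have hid := hM.integrable_id
  refine ⟨M.σ * √M.δt * M.Q + a, b + a * ∫ e, |e| ∂M.innovationLaw, by positivity,
    fun z v => ?_⟩
  set C := M.L (v / M.meanVolume (k + 1)) * M.meanVolume (k + 1) * M.δt with hC
  -- The minorant: the next spread is at most `|z.2| + |e|` in absolute value, and `M.Q / (k + 1)`
  -- is at most `M.Q`.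
  let h : ℝ → ℝ := fun e => (M.γ * (M.σ * √M.δt * (z.1 - M.Q / (k + 1)))) * e
    - (M.γ * a) * |e| + M.γ * (C - (M.σ * √M.δt * M.Q + a) * |z.2| - b)
  have hi1 : Integrable (fun e => (M.γ * (M.σ * √M.δt * (z.1 - M.Q / (k + 1)))) * e)
      M.innovationLaw := hid.const_mul _
  have hi2 : Integrable (fun e => (M.γ * a) * |e|) M.innovationLaw := hid.abs.const_mul _
  have hint : Integrable h M.innovationLaw := (hi1.sub hi2).add (integrable_const _)
  have hval : ∫ e, h e ∂M.innovationLaw = M.γ *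
      (C - (M.σ * √M.δt * M.Q + a) * |z.2| - (b + a * ∫ e, |e| ∂M.innovationLaw)) := by
    have e1 : ∫ e, h e ∂M.innovationLaw =
        (∫ e, ((M.γ * (M.σ * √M.δt * (z.1 - M.Q / (k + 1)))) * e - (M.γ * a) * |e|)
          ∂M.innovationLaw) + ∫ _, M.γ * (C - (M.σ * √M.δt * M.Q + a) * |z.2| - b)
          ∂M.innovationLaw := integral_add (hi1.sub hi2) (integrable_const _)
    rw [e1, integral_sub hi1 hi2, integral_const_mul, integral_const_mul, hM.integral_id]
    simp
    ring
  rw [← hval]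
  refine (ofReal_exp_integral_le_lintegral _ hint).trans (lintegral_mono fun e => ?_)
  refine le_trans ?_ (mul_le_mul_right (hab _) _)
  rw [← ENNReal.ofReal_mul (Real.exp_pos _).le, ← Real.exp_add]
  refine ENNReal.ofReal_le_ofReal (Real.exp_le_exp.2 ?_)
  simp only [h, stepCost, nextState]
  rw [← hC]
  have hk : (0 : ℝ) < k + 1 := by positivity
  have h1 : M.Q / (k + 1) * z.2 ≤ M.Q * |z.2| := by
    have : M.Q / (k + 1) ≤ M.Q := div_le_self hQ.le (by linarith)
    calc M.Q / (k + 1) * z.2 ≤ M.Q / (k + 1) * |z.2| := by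
          gcongr
          exact le_abs_self _
      _ ≤ M.Q * |z.2| := by gcongr
  have h2 : |(k : ℝ) / (k + 1) * (z.2 + e)| ≤ |z.2| + |e| := by
    rw [abs_mul, abs_of_nonneg (by positivity : (0 : ℝ) ≤ k / (k + 1))]
    have : (k : ℝ) / (k + 1) ≤ 1 := by rw [div_le_one hk]; linarith
    calc (k : ℝ) / (k + 1) * |z.2 + e| ≤ 1 * |z.2 + e| := by gcongr
      _ ≤ |z.2| + |e| := by rw [one_mul]; exact abs_add_le _ _
  have h3 := mul_le_mul_of_nonneg_left h1 hc
  have h4 := mul_le_mul_of_nonneg_left h2 ha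
  have h5 : (M.σ * √M.δt * (z.1 - M.Q / (k + 1))) * e - a * |e| +
      (C - (M.σ * √M.δt * M.Q + a) * |z.2| - b) ≤
      (M.σ * √M.δt * ((z.1 - M.Q / (k + 1)) * e - M.Q / (k + 1) * z.2) + C) +
        (-(a * |(k : ℝ) / (k + 1) * (z.2 + e)|) - b) := by linarith
  have h6 := mul_le_mul_of_nonneg_left h5 hγ.le
  linarith

theorem StandingAssumptions.exists_abs_le_of_L_le (K : ℝ) : ∃ B, ∀ ρ, M.L ρ ≤ K → |ρ| ≤ B := by
  have h1 : Tendsto M.L atTop atTop := by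
    refine tendsto_atTop_mono' atTop ?_ hM.L_superlinear
    filter_upwards [eventually_ge_atTop 1] with ρ hρ using div_le_self (hM.L_nonneg ρ) hρ
  obtain ⟨B, hB⟩ := eventually_atTop.1 (h1.eventually_gt_atTop K)
  refine ⟨B, fun ρ hρ => ?_⟩
  by_contra hlt
  have h2 := hB |ρ| (not_le.1 hlt).le
  have h3 : M.L |ρ| = M.L ρ := by
    rcases abs_choice ρ with h | h <;> rw [h]
    exact hM.L_even ρ
  linarith

/-- In the lower bound for the continuation value the state appears only through `|z.2|`, which is
bounded on balls; a bound on the value therefore bounds `L`, hence the rate. -/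
theorem StandingAssumptions.locallyCoercive_continuation {w : ℝ × ℝ → ℝ≥0∞}
    (hw : M.HasExpLowerBound w) {k : ℕ} (hk : k < M.N) :
    LocallyCoercive (M.continuation k w) := by
  intro z₀ R c hc
  obtain ⟨a, b, ha, hab⟩ := hM.exists_le_continuation hw k
  have hV := (hM.volume_ae_eq (Nat.le_add_left 1 k) hk).1
  have hγ := hM.γ_pos
  have hδ := hM.δt_pos
  set U := M.meanVolume (k + 1)
  obtain ⟨B, hB⟩ := hM.exists_abs_le_of_L_le ((c.toReal / M.γ + a * (|z₀.2| + R) + b) / (U * M.δt))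
  refine ⟨B * U, fun z hz v hv => ?_⟩
  have h1 := (hab z v).trans hv
  rw [ENNReal.ofReal_le_iff_le_toReal hc] at h1
  -- The crude bound `x + 1 ≤ exp x` replaces a logarithm, and also covers a sublevel `c = 0`.
  have h2 := (Real.add_one_le_exp _).trans h1
  have h3 : |z.2| ≤ |z₀.2| + R := by
    have h4 : |z.2 - z₀.2| ≤ R := (le_max_right _ _).trans hz
    have := abs_sub_abs_le_abs_sub z.2 z₀.2
    linarith
  have h5 : M.L (v / U) * U * M.δt - a * |z.2| - b ≤ c.toReal / M.γ := by
    rw [le_div_iff₀ hγ]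
    linarith
  have h6 := mul_le_mul_of_nonneg_left h3 ha
  have h7 : M.L (v / U) ≤ (c.toReal / M.γ + a * (|z₀.2| + R) + b) / (U * M.δt) := by
    rw [le_div_iff₀ (by positivity)]
    linarith
  have h8 := hB _ h7
  rwa [abs_div, abs_of_pos hV, div_le_iff₀ hV] at h8

/-- The two properties must be propagated together: the lower bound at `k + 1` yields coercivity at
`k`, without which the infimum over rates need not stay lower semicontinuous. -/
theorem StandingAssumptions.dp_regular {k : ℕ} (hk : k ≤ M.N) :
    LowerSemicontinuous (M.dp k) ∧ M.HasExpLowerBound (M.dp k) := by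
  refine Nat.decreasingInduction (motive := fun k _ =>
    LowerSemicontinuous (M.dp k) ∧ M.HasExpLowerBound (M.dp k)) (fun k hk ih => ?_) ?_ hk
  · obtain ⟨a, b, ha, hab⟩ := hM.exists_le_continuation ih.2 k
    have hV := (hM.volume_ae_eq (Nat.le_add_left 1 k) hk).1
    have hpen : LowerSemicontinuous fun z : ℝ × ℝ => M.penalty z.1 :=
      hM.lowerSemicontinuous_penalty.comp continuous_fst
    have hinf : LowerSemicontinuous fun z => ⨅ v, M.continuation k (M.dp (k + 1)) z v := by
      simpa using (hM.locallyCoercive_continuation ih.2 hk).lowerSemicontinuous_iInf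
        (hM.lowerSemicontinuous_continuation ih.1 k) isClosed_univ
    have hγ := hM.γ_pos
    -- Taking `|b|` instead of `b` makes the bound at most `1`, so that it lies below the penalty as
    -- well.
    have hlow : ∀ z : ℝ × ℝ, ENNReal.ofReal (Real.exp (M.γ * (-(a * |z.2|) - |b|))) ≤
        ⨅ v, M.continuation k (M.dp (k + 1)) z v := fun z => le_iInf fun v => by
      refine le_trans (ENNReal.ofReal_le_ofReal (Real.exp_le_exp.2 ?_)) (hab z v)
      have := mul_nonneg (mul_nonneg (hM.L_nonneg (v / M.meanVolume (k + 1))) hV.le)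
        hM.δt_pos.le
      have := le_abs_self b
      gcongr
      linarith
    have hlow' : ∀ z : ℝ × ℝ, ENNReal.ofReal (Real.exp (M.γ * (-(a * |z.2|) - |b|))) ≤
        M.penalty z.1 := fun z => by
      refine le_trans ?_ (hM.one_le_penalty _)
      rw [ENNReal.ofReal_le_one, Real.exp_le_one_iff]
      have : 0 ≤ a * |z.2| := by positivity
      exact mul_nonpos_of_nonneg_of_nonpos hγ.le (by linarith [abs_nonneg b])
    have hdp := funext (M.dp_of_lt hk)
    rw [hdp]
    by_cases hk' : k ∈ M.𝒩
    · simp only [hk', if_true]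
      exact ⟨hinf.inf hpen, a, |b|, ha, fun z => le_min (hlow z) (hlow' z)⟩
    · simp only [hk', if_false]
      exact ⟨hinf, a, |b|, ha, hlow⟩
  · have hdp : M.dp M.N = fun z : ℝ × ℝ => M.penalty z.1 := funext M.dp_terminal
    rw [hdp]
    exact ⟨hM.lowerSemicontinuous_penalty.comp continuous_fst, 0, 0, le_rfl,
      fun z => by simpa using hM.one_le_penalty z.1⟩

theorem StandingAssumptions.dp_ne_zero {k : ℕ} (hk : k ≤ M.N) (z : ℝ × ℝ) : M.dp k z ≠ 0 := by
  obtain ⟨a, b, -, h⟩ := (hM.dp_regular hk).2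
  exact ((ENNReal.ofReal_pos.2 (Real.exp_pos _)).trans_le (h z)).ne'

theorem StandingAssumptions.exists_measurable_optimal_rate {k : ℕ} (hk : k < M.N) :
    ∃ φ : ℝ × ℝ → ℝ, Measurable φ ∧ ∀ z, M.continuation k (M.dp (k + 1)) z (φ z) =
      ⨅ v, M.continuation k (M.dp (k + 1)) z v :=
  (hM.locallyCoercive_continuation (hM.dp_regular hk).2 hk).exists_measurable_argmin
    (hM.lowerSemicontinuous_continuation (hM.dp_regular hk).1 k)

/-! ### Finiteness under two-sided exponential moments. -/

section UpperBound

variable (hexp : ∀ t : ℝ, Integrable (fun ω => Real.exp (t * M.ε 1 ω)) M.P)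

include hexp

theorem StandingAssumptions.lintegral_exp_mul_add_abs_lt_top (s t : ℝ) :
    ∫⁻ e, ENNReal.ofReal (Real.exp (s * e + t * |e|)) ∂M.innovationLaw < ∞ := by
  have hε := hM.measurable_ε le_rfl hM.one_le_N
  have hi : ∀ t : ℝ, Integrable (fun e => Real.exp (t * e)) M.innovationLaw := fun t => by
    rw [innovationLaw, integrable_map_measure
      (by fun_prop : Continuous fun e : ℝ => Real.exp (t * e)).aestronglyMeasurable
      hε.aemeasurable]
    exact hexp t
  -- The integrand equals one of these two exponentials according to the sign of `e`, so their sum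
  -- dominates it.
  have h := (hi (s + t)).add (hi (s - t))
  refine lt_of_le_of_lt (lintegral_mono fun e => ENNReal.ofReal_le_ofReal ?_)
    (h.lintegral_lt_top)
  have h1 := Real.exp_pos ((s + t) * e)
  have h2 := Real.exp_pos ((s - t) * e)
  simp only [Pi.add_apply]
  rcases abs_choice e with he | he <;> rw [he]
  · rw [show s * e + t * e = (s + t) * e by ring]
    linarith
  · rw [show s * e + t * -e = (s - t) * e by ring]
    linarith

/-- The continuation value is finite if the future cost grows at most exponentially in `Z`. -/
theorem StandingAssumptions.exists_continuation_le {w : ℝ × ℝ → ℝ≥0∞} {C : ℝ≥0∞} {d : ℝ}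
    (hC : C ≠ ∞) (hd : 0 ≤ d) {q v : ℝ} (k : ℕ)
    (hw : ∀ Z, w (q - v * M.δt, Z) ≤ C * ENNReal.ofReal (Real.exp (d * |Z|))) :
    ∃ C' : ℝ≥0∞, C' ≠ ∞ ∧ ∃ d' : ℝ, 0 ≤ d' ∧ ∀ Z,
      M.continuation k w (q, Z) v ≤ C' * ENNReal.ofReal (Real.exp (d' * |Z|)) := by
  have hγ := hM.γ_pos
  have hQ := hM.Q_pos
  have hc : 0 ≤ M.σ * √M.δt := mul_nonneg hM.σ_pos.le (Real.sqrt_nonneg _)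
  have hk : (0 : ℝ) < k + 1 := by positivity
  set K := M.L (v / M.meanVolume (k + 1)) * M.meanVolume (k + 1) * M.δt with hK
  set s := M.γ * (M.σ * √M.δt * (q - M.Q / (k + 1))) with hs
  set d₁ := M.γ * (M.σ * √M.δt * (M.Q / (k + 1))) with hd₁
  have hI := hM.lintegral_exp_mul_add_abs_lt_top hexp s d
  refine ⟨C * ENNReal.ofReal (Real.exp (M.γ * K)) *
    ∫⁻ e, ENNReal.ofReal (Real.exp (s * e + d * |e|)) ∂M.innovationLaw,
    ENNReal.mul_ne_top (ENNReal.mul_ne_top hC ENNReal.ofReal_ne_top) hI.ne, d₁ + d,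
    by positivity, fun Z => ?_⟩
  rw [mul_assoc C, mul_comm _ (∫⁻ _, _ ∂_), mul_assoc, mul_assoc, mul_comm (∫⁻ _, _ ∂_),
    ← mul_assoc, ← lintegral_const_mul' _ _ (ENNReal.mul_ne_top hC
      (ENNReal.mul_ne_top ENNReal.ofReal_ne_top ENNReal.ofReal_ne_top))]
  refine lintegral_mono fun e => ?_
  refine (mul_le_mul_right (hw _) _).trans ?_
  rw [← ENNReal.ofReal_mul (Real.exp_pos _).le, mul_assoc C,
    ← ENNReal.ofReal_mul (by positivity), mul_left_comm,
    ← ENNReal.ofReal_mul (by positivity), ← Real.exp_add, ← Real.exp_add, ← Real.exp_add]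
  refine mul_le_mul_right (ENNReal.ofReal_le_ofReal (Real.exp_le_exp.2 ?_)) _
  simp only [stepCost]
  rw [← hK]
  have h2 : |(k : ℝ) / (k + 1) * (Z + e)| ≤ |Z| + |e| := by
    rw [abs_mul, abs_of_nonneg (by positivity : (0 : ℝ) ≤ k / (k + 1))]
    have : (k : ℝ) / (k + 1) ≤ 1 := by rw [div_le_one hk]; linarith
    calc (k : ℝ) / (k + 1) * |Z + e| ≤ 1 * |Z + e| := by gcongr
      _ ≤ |Z| + |e| := by rw [one_mul]; exact abs_add_le _ _
  have h3 := mul_le_mul_of_nonneg_left h2 hd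
  have h4 : d₁ * (-Z) ≤ d₁ * |Z| := by
    have : 0 ≤ d₁ := by positivity
    gcongr
    exact neg_le_abs Z
  have h5 : M.γ * (M.σ * √M.δt * ((q - M.Q / (k + 1)) * e - M.Q / (k + 1) * Z) + K) =
      s * e + d₁ * (-Z) + M.γ * K := by rw [hs, hd₁]; ring
  rw [h5]
  linarith

/-- With zero inventory and no trading the state stays on the line `q = 0`, where the penalty is `1`
even if `ℓ` is infinite elsewhere. -/
theorem StandingAssumptions.exists_dp_zero_le {k : ℕ} (hk : k ≤ M.N) :
    ∃ C : ℝ≥0∞, C ≠ ∞ ∧ ∃ d : ℝ, 0 ≤ d ∧ ∀ Z,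
      M.dp k (0, Z) ≤ C * ENNReal.ofReal (Real.exp (d * |Z|)) := by
  refine Nat.decreasingInduction (motive := fun k _ => ∃ C : ℝ≥0∞, C ≠ ∞ ∧ ∃ d : ℝ, 0 ≤ d ∧
    ∀ Z, M.dp k (0, Z) ≤ C * ENNReal.ofReal (Real.exp (d * |Z|))) (fun k hk ih => ?_) ?_ hk
  · obtain ⟨C, hC, d, hd, h⟩ := ih
    obtain ⟨C', hC', d', hd', h'⟩ := hM.exists_continuation_le hexp (q := 0) (v := 0) hC hd k
      (w := M.dp (k + 1)) (by simpa using h)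
    exact ⟨C', hC', d', hd', fun Z => (M.dp_le_continuation hk _ 0).trans (h' Z)⟩
  · exact ⟨1, by simp, 0, le_rfl, fun Z => by simp [dp_terminal, hM.penalty_zero]⟩

theorem StandingAssumptions.dp_ne_top {k : ℕ} (hk : k < M.N) (z : ℝ × ℝ) : M.dp k z ≠ ∞ := by
  -- The rate `z.1 / δt` clears the inventory in one period, which requires `k < N`.
  obtain ⟨C, hC, d, hd, h⟩ := hM.exists_dp_zero_le hexp (k := k + 1) hk
  obtain ⟨C', hC', d', -, h'⟩ := hM.exists_continuation_le hexp (q := z.1) (v := z.1 / M.δt)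
    hC hd k (w := M.dp (k + 1)) (by simpa [div_mul_cancel₀ _ hM.δt_pos.ne'] using h)
  exact ne_top_of_le_ne_top (ENNReal.mul_ne_top hC' ENNReal.ofReal_ne_top)
    ((M.dp_le_continuation hk z _).trans (h' z.2))

end UpperBound

end DynamicProgramming
end Model
end ASR

namespace ASR
open scoped Topology
namespace Model

variable {Ω : Type*} [mΩ : MeasurableSpace Ω]

/-! ### Verification: the recursion computes the infimum over strategies. -/

section Verification

variable (M : Model Ω)

/-- The normalised difference between price and average price at time `k`, from `Z` at time
`n`. -/
noncomputable def spread (n : ℕ) (Z : ℝ) (k : ℕ) (ω : Ω) : ℝ :=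
  (n * Z + ∑ j ∈ Finset.Ico n k, (j : ℝ) * M.ε (j + 1) ω) / k

/-- The reduced state at time `k`, starting from `(q, Z)` at time `n`. -/
noncomputable def state (n : ℕ) (q Z : ℝ) (v : ℕ → Ω → ℝ) (k : ℕ) (ω : Ω) : ℝ × ℝ :=
  (M.inventory n q v k ω, M.spread n Z k ω)

/-- The accumulated cost between times `n` and `k`. -/
noncomputable def runningCost (n : ℕ) (q Z : ℝ) (v : ℕ → Ω → ℝ) (k : ℕ) (ω : Ω) : ℝ :=
  ∑ j ∈ Finset.Ico n k, M.stepCost j (M.state n q Z v j ω) (v j ω) (M.ε (j + 1) ω)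

/-- The exponential of the accumulated cost. -/
noncomputable def expCost (n : ℕ) (q Z : ℝ) (v : ℕ → Ω → ℝ) (k : ℕ) (ω : Ω) : ℝ≥0∞ :=
  ENNReal.ofReal (Real.exp (M.γ * M.runningCost n q Z v k ω))

/-- The exponential cost of a strategy. -/
noncomputable def reducedCost (n : ℕ) (q Z : ℝ) (s : M.Strategy n) : ℝ≥0∞ :=
  ∫⁻ ω, M.expCost n q Z s.v (s.τ ω) ω * M.penalty (M.inventory n q s.v (s.τ ω) ω) ∂M.P

/-- The cost of a strategy that is continued optimally from time `k` on. -/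
noncomputable def costUntil (n : ℕ) (q Z : ℝ) (s : M.Strategy n) (k : ℕ) (ω : Ω) : ℝ≥0∞ :=
  -- The inequality is strict: delivery at `k` itself is still valued by `dp k`. Hence at `k = n`
  -- the cost is the constant `dp n (q, Z)`, even when `τ = n`.
  if s.τ ω < k then
    M.expCost n q Z s.v (s.τ ω) ω * M.penalty (M.inventory n q s.v (s.τ ω) ω)
  else M.expCost n q Z s.v k ω * M.dp k (M.state n q Z s.v k ω)

theorem spread_self {n : ℕ} (hn : 1 ≤ n) (Z : ℝ) (ω : Ω) : M.spread n Z n ω = Z := by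
  have : (n : ℝ) ≠ 0 := by positivity
  simp [spread, this]

theorem spread_succ {n k : ℕ} (hn : 1 ≤ n) (hk : n ≤ k) (Z : ℝ) (ω : Ω) :
    M.spread n Z (k + 1) ω = (k : ℝ) / (k + 1) * (M.spread n Z k ω + M.ε (k + 1) ω) := by
  have h0 : (0 : ℝ) < k := by exact_mod_cast hn.trans hk
  simp only [spread, Finset.sum_Ico_succ_top hk]
  push_cast
  field_simp
  ring

theorem state_self {n : ℕ} (hn : 1 ≤ n) (q Z : ℝ) (v : ℕ → Ω → ℝ) (ω : Ω) :
    M.state n q Z v n ω = (q, Z) := by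
  simp [state, spread_self M hn, inventory]

theorem state_succ {n k : ℕ} (hn : 1 ≤ n) (hk : n ≤ k) (q Z : ℝ) (v : ℕ → Ω → ℝ) (ω : Ω) :
    M.state n q Z v (k + 1) ω =
      M.nextState k (M.state n q Z v k ω) (v k ω) (M.ε (k + 1) ω) := by
  simp only [state, spread_succ M hn hk, nextState, inventory, Finset.sum_Ico_succ_top hk]
  congr 1
  ring

theorem expCost_self (n : ℕ) (q Z : ℝ) (v : ℕ → Ω → ℝ) (ω : Ω) :
    M.expCost n q Z v n ω = 1 := by
  simp [expCost, runningCost]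

theorem expCost_succ {n k : ℕ} (hk : n ≤ k) (q Z : ℝ) (v : ℕ → Ω → ℝ) (ω : Ω) :
    M.expCost n q Z v (k + 1) ω = M.expCost n q Z v k ω * ENNReal.ofReal (Real.exp
      (M.γ * M.stepCost k (M.state n q Z v k ω) (v k ω) (M.ε (k + 1) ω))) := by
  rw [expCost, expCost, ← ENNReal.ofReal_mul (Real.exp_pos _).le, ← Real.exp_add, runningCost,
    Finset.sum_Ico_succ_top hk, mul_add]
  rfl

variable {M} (hM : M.StandingAssumptions)

include hM

theorem StandingAssumptions.measurable_ε_of_le {j k : ℕ} (h1 : 1 ≤ j) (hjk : j ≤ k)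
    (hk : k ≤ M.N) : Measurable[M.ℱ k] (M.ε j) :=
  (hM.ε_measurable j h1 (hjk.trans hk)).mono (M.ℱ.mono hjk) le_rfl

theorem StandingAssumptions.measurable_state {n k : ℕ} (hkN : k ≤ M.N) (q Z : ℝ)
    {v : ℕ → Ω → ℝ} (hv : ∀ k, n ≤ k → k < M.N → Measurable[M.ℱ k] (v k)) :
    Measurable[M.ℱ k] (M.state n q Z v k) := by
  refine Measurable.prodMk ?_ ?_
  · refine measurable_const.sub (Finset.measurable_fun_sum _ fun j hj => ?_)
    obtain ⟨h1, h2⟩ := Finset.mem_Ico.1 hj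
    exact ((hv j h1 (h2.trans_le hkN)).mono (M.ℱ.mono h2.le) le_rfl).mul_const _
  · refine (measurable_const.add (Finset.measurable_fun_sum _ fun j hj => ?_)).div_const _
    obtain ⟨h1, h2⟩ := Finset.mem_Ico.1 hj
    exact (hM.measurable_ε_of_le (Nat.le_add_left 1 j) h2 hkN).const_mul _

theorem StandingAssumptions.measurable_expCost {n k : ℕ} (hkN : k ≤ M.N) (q Z : ℝ)
    {v : ℕ → Ω → ℝ} (hv : ∀ k, n ≤ k → k < M.N → Measurable[M.ℱ k] (v k)) :
    Measurable[M.ℱ k] (M.expCost n q Z v k) := by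
  refine ENNReal.measurable_ofReal.comp (Real.measurable_exp.comp (Measurable.const_mul
    (Finset.measurable_fun_sum _ fun j hj => ?_) _))
  obtain ⟨h1, h2⟩ := Finset.mem_Ico.1 hj
  have hs := (hM.measurable_state (h2.le.trans hkN) q Z hv).mono (M.ℱ.mono h2.le) le_rfl
  have hv' := (hv j h1 (h2.trans_le hkN)).mono (M.ℱ.mono h2.le) le_rfl
  exact (hM.continuous_stepCost j).measurable.comp
    ((hs.prodMk hv').prodMk (hM.measurable_ε_of_le (Nat.le_add_left 1 j) h2 hkN))

/-- The one-step martingale identity: past cost, state, rate and `B` are known at time `k`, and the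
next innovation is independent of them. It is used with `B` the event that delivery comes after `k`.
-/
theorem StandingAssumptions.lintegral_indicator_continuation {n k : ℕ} (hn : 1 ≤ n)
    (hnk : n ≤ k) (hk : k < M.N) (q Z : ℝ) {v : ℕ → Ω → ℝ}
    (hv : ∀ k, n ≤ k → k < M.N → Measurable[M.ℱ k] (v k)) {B : Set Ω}
    (hB : MeasurableSet[M.ℱ k] B) :
    ∫⁻ ω, B.indicator (fun ω => M.expCost n q Z v k ω *
        M.continuation k (M.dp (k + 1)) (M.state n q Z v k ω) (v k ω)) ω ∂M.P =
      ∫⁻ ω, B.indicator (fun ω => M.expCost n q Z v (k + 1) ω *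
        M.dp (k + 1) (M.state n q Z v (k + 1) ω)) ω ∂M.P := by
  have := hM.isProbabilityMeasure
  obtain ⟨H, hH⟩ : ∃ H : ((ℝ × ℝ) × ℝ) × ℝ → ℝ≥0∞, H = fun p =>
      ENNReal.ofReal (Real.exp (M.γ * M.stepCost k p.1.1 p.1.2 p.2)) *
        M.dp (k + 1) (M.nextState k p.1.1 p.1.2 p.2) := ⟨_, rfl⟩
  have hHm : Measurable H := by
    rw [hH]
    exact (hM.lowerSemicontinuous_integrand (hM.dp_regular (k := k + 1) hk).1 k).measurable
  have hHc : ∀ z u, M.continuation k (M.dp (k + 1)) z u = ∫⁻ e, H ((z, u), e)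
      ∂M.innovationLaw := fun z u => by rw [hH]; rfl
  -- The first coordinate of `x` carries the accumulated cost and the indicator of `B`, so that both
  -- are frozen together with the state.
  let h : ℝ≥0∞ × ((ℝ × ℝ) × ℝ) → ℝ → ℝ≥0∞ := fun x e => x.1 * H (x.2, e)
  have hh : Measurable fun p : (ℝ≥0∞ × ((ℝ × ℝ) × ℝ)) × ℝ => h p.1 p.2 := by
    dsimp only [h]
    fun_prop
  have hX : Measurable[M.ℱ k] fun ω =>
      (B.indicator (M.expCost n q Z v k) ω, (M.state n q Z v k ω, v k ω)) :=
    ((hM.measurable_expCost hk.le q Z hv).indicator hB).prodMk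
      ((hM.measurable_state hk.le q Z hv).prodMk (hv k hnk hk))
  have key := lintegral_eq_lintegral_lintegral_of_indep (M.ℱ.le k) hX
    (hM.measurable_ε (Nat.le_add_left 1 k) hk) (hM.ε_indep k hk) hh
  rw [hM.map_ε (Nat.le_add_left 1 k) hk] at key
  have e1 : ∀ ω, h (B.indicator (M.expCost n q Z v k) ω, (M.state n q Z v k ω, v k ω))
      (M.ε (k + 1) ω) = B.indicator (fun ω => M.expCost n q Z v (k + 1) ω *
        M.dp (k + 1) (M.state n q Z v (k + 1) ω)) ω := fun ω => by
    by_cases hω : ω ∈ B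
    · simp only [h, hH, indicator_of_mem hω, expCost_succ M hnk, state_succ M hn hnk, mul_assoc]
    · simp only [h, indicator_of_notMem hω, zero_mul]
  have e2 : ∀ ω, ∫⁻ e, h (B.indicator (M.expCost n q Z v k) ω, (M.state n q Z v k ω, v k ω)) e
      ∂M.innovationLaw = B.indicator (fun ω => M.expCost n q Z v k ω *
        M.continuation k (M.dp (k + 1)) (M.state n q Z v k ω) (v k ω)) ω := fun ω => by
    have hm : Measurable fun e => H ((M.state n q Z v k ω, v k ω), e) := by fun_prop
    simp only [h]
    rw [lintegral_const_mul _ hm, ← hHc]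
    by_cases hω : ω ∈ B
    · simp only [indicator_of_mem hω]
    · simp only [indicator_of_notMem hω, zero_mul]
  simp only [e1, e2] at key
  exact key.symm

omit hM in
theorem Strategy.measurableSet_lt {n : ℕ} (s : M.Strategy n) (k : ℕ) :
    MeasurableSet[M.ℱ k] {ω | k < s.τ ω} := by
  have h : {ω | k < s.τ ω} = {ω | (s.τ ω : WithTop ℕ) ≤ (k : ℕ)}ᶜ := by
    ext ω
    simp
  rw [h]
  exact (s.isStoppingTime k).compl

theorem Strategy.τ_le {n : ℕ} (s : M.Strategy n) (ω : Ω) : s.τ ω ≤ M.N := by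
  rcases Finset.mem_insert.1 (s.mem_dates ω) with h | h
  · exact h.le
  · exact (hM.dates_subset _ h).2.le

theorem StandingAssumptions.lintegral_costUntil_succ {n k : ℕ} (hn : 1 ≤ n)
    (hnk : n ≤ k) (hk : k < M.N) (q Z : ℝ) (s : M.Strategy n) :
    ∫⁻ ω, M.costUntil n q Z s (k + 1) ω ∂M.P =
      ∫⁻ ω, (if k < s.τ ω then M.expCost n q Z s.v k ω *
          M.continuation k (M.dp (k + 1)) (M.state n q Z s.v k ω) (s.v k ω)
        else M.expCost n q Z s.v (s.τ ω) ω * M.penalty (M.inventory n q s.v (s.τ ω) ω)) ∂M.P := by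
  have hB := s.measurableSet_lt k
  have hB' := M.ℱ.le k _ hB
  have key := hM.lintegral_indicator_continuation hn hnk hk q Z s.adapted hB
  have h1 : Measurable ({ω | k < s.τ ω}.indicator fun ω => M.expCost n q Z s.v k ω *
      M.continuation k (M.dp (k + 1)) (M.state n q Z s.v k ω) (s.v k ω)) := by
    have hG : Measurable fun ω => M.expCost n q Z s.v k ω :=
      (hM.measurable_expCost hk.le q Z s.adapted).mono (M.ℱ.le k) le_rfl
    have hC := (hM.lowerSemicontinuous_continuation (hM.dp_regular (k := k + 1) hk).1
      k).measurable
    have hX : Measurable fun ω => (M.state n q Z s.v k ω, s.v k ω) :=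
      ((hM.measurable_state hk.le q Z s.adapted).mono (M.ℱ.le k) le_rfl).prodMk
        ((s.adapted k hnk hk).mono (M.ℱ.le k) le_rfl)
    exact (hG.mul (hC.comp hX)).indicator hB'
  have h2 : Measurable ({ω | k < s.τ ω}.indicator fun ω => M.expCost n q Z s.v (k + 1) ω *
      M.dp (k + 1) (M.state n q Z s.v (k + 1) ω)) := by
    have hG : Measurable fun ω => M.expCost n q Z s.v (k + 1) ω :=
      (hM.measurable_expCost hk q Z s.adapted).mono (M.ℱ.le _) le_rfl
    have hX : Measurable fun ω => M.state n q Z s.v (k + 1) ω :=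
      (hM.measurable_state hk q Z s.adapted).mono (M.ℱ.le _) le_rfl
    exact (hG.mul ((hM.dp_regular (k := k + 1) hk).1.measurable.comp hX)).indicator hB'
  -- The cost of paths already delivered, common to both sides. It involves quantities evaluated at
  -- `τ`, but its measurability is not needed: the other summand is measurable, and that suffices to
  -- split the integral.
  let A : Ω → ℝ≥0∞ := {ω | k < s.τ ω}ᶜ.indicator fun ω =>
    M.expCost n q Z s.v (s.τ ω) ω * M.penalty (M.inventory n q s.v (s.τ ω) ω)
  calc _ = ∫⁻ ω, A ω + {ω | k < s.τ ω}.indicator (fun ω => M.expCost n q Z s.v (k + 1) ω *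
            M.dp (k + 1) (M.state n q Z s.v (k + 1) ω)) ω ∂M.P := by
        refine lintegral_congr fun ω => ?_
        by_cases hω : k < s.τ ω
        · simp [A, costUntil, hω, show ¬ s.τ ω < k + 1 by omega]
        · simp [A, costUntil, hω, show s.τ ω < k + 1 by omega]
    _ = ∫⁻ ω, A ω + {ω | k < s.τ ω}.indicator (fun ω => M.expCost n q Z s.v k ω *
            M.continuation k (M.dp (k + 1)) (M.state n q Z s.v k ω) (s.v k ω)) ω ∂M.P := by
        rw [lintegral_add_right _ h1, lintegral_add_right _ h2, key]
    _ = _ := by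
        refine lintegral_congr fun ω => ?_
        by_cases hω : k < s.τ ω <;> simp [A, hω]

theorem StandingAssumptions.lintegral_costUntil_self {n : ℕ} (hn : 1 ≤ n) (q Z : ℝ)
    (s : M.Strategy n) : ∫⁻ ω, M.costUntil n q Z s n ω ∂M.P = M.dp n (q, Z) := by
  have := hM.isProbabilityMeasure
  have h : ∀ ω, M.costUntil n q Z s n ω = M.dp n (q, Z) := fun ω => by
    rw [costUntil, if_neg (s.le_τ ω).not_gt, expCost_self, state_self M hn, one_mul]
  simp [h]

theorem StandingAssumptions.lintegral_costUntil_terminal {n : ℕ} (q Z : ℝ)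
    (s : M.Strategy n) : ∫⁻ ω, M.costUntil n q Z s M.N ω ∂M.P = M.reducedCost n q Z s := by
  refine lintegral_congr fun ω => ?_
  rcases (s.τ_le hM ω).lt_or_eq with h | h
  · rw [costUntil, if_pos h]
  · rw [costUntil, if_neg h.not_lt, dp_terminal, ← h]
    rfl

/-- The expectation of `costUntil` is nondecreasing in `k`, since `dp` is at most both the
continuation value and, on admissible dates, the penalty. It runs from `dp` at `n` to the cost of
the strategy at `N`. -/
theorem StandingAssumptions.dp_le_reducedCost {n : ℕ} (hn : 1 ≤ n) (hnN : n ≤ M.N) (q Z : ℝ)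
    (s : M.Strategy n) : M.dp n (q, Z) ≤ M.reducedCost n q Z s := by
  have key : ∀ k, n ≤ k → k ≤ M.N → M.dp n (q, Z) ≤ ∫⁻ ω, M.costUntil n q Z s k ω ∂M.P := by
    intro k hk
    induction k, hk using Nat.le_induction with
    | base => exact fun _ => (hM.lintegral_costUntil_self hn q Z s).ge
    | succ k hnk ih =>
      intro hk
      refine (ih (by omega)).trans ?_
      rw [hM.lintegral_costUntil_succ hn hnk hk q Z s]
      refine lintegral_mono fun ω => ?_
      rcases lt_trichotomy k (s.τ ω) with h | h | h
      · simp only [costUntil, if_pos h, if_neg h.not_gt]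
        exact mul_le_mul_right (M.dp_le_continuation hk _ _) _
      · simp only [costUntil, ← h, lt_irrefl, if_false]
        exact mul_le_mul_right (M.dp_le_penalty (h ▸ s.mem_dates ω) (by omega) _) _
      · simp only [costUntil, if_neg h.not_gt, if_pos h]
        exact le_rfl
  exact (key M.N hnN le_rfl).trans (hM.lintegral_costUntil_terminal q Z s).le

theorem StandingAssumptions.reducedCost_eq_dp {n : ℕ} (hn : 1 ≤ n) (hnN : n ≤ M.N) (q Z : ℝ)
    (s : M.Strategy n)
    (hcont : ∀ k ω, n ≤ k → k < M.N → k < s.τ ω → M.dp k (M.state n q Z s.v k ω) =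
      M.continuation k (M.dp (k + 1)) (M.state n q Z s.v k ω) (s.v k ω))
    (hdeliver : ∀ k ω, k < M.N → k = s.τ ω →
      M.dp k (M.state n q Z s.v k ω) = M.penalty (M.state n q Z s.v k ω).1) :
    M.reducedCost n q Z s = M.dp n (q, Z) := by
  have key : ∀ k, n ≤ k → k ≤ M.N → ∫⁻ ω, M.costUntil n q Z s k ω ∂M.P = M.dp n (q, Z) := by
    intro k hk
    induction k, hk using Nat.le_induction with
    | base => exact fun _ => hM.lintegral_costUntil_self hn q Z s
    | succ k hnk ih =>
      intro hk
      rw [← ih (by omega), hM.lintegral_costUntil_succ hn hnk hk q Z s]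
      refine lintegral_congr fun ω => ?_
      rcases lt_trichotomy k (s.τ ω) with h | h | h
      · simp only [costUntil, if_pos h, if_neg h.not_gt, hcont k ω hnk hk h]
      · simp only [costUntil, if_neg h.not_lt, if_neg h.not_gt, hdeliver k ω hk h]
        rw [← h]
        rfl
      · simp only [costUntil, if_neg h.not_gt, if_pos h]
  rw [← hM.lintegral_costUntil_terminal q Z s, key M.N hnN le_rfl]

/-- There is an optimal strategy, given by a feedback rule. -/
theorem StandingAssumptions.exists_reducedCost_eq_dp {n : ℕ} (hn : 1 ≤ n) (hnN : n ≤ M.N)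
    (q Z : ℝ) : ∃ s : M.Strategy n, M.reducedCost n q Z s = M.dp n (q, Z) := by
  classical
  have hφ : ∀ k, ∃ φ : ℝ × ℝ → ℝ, Measurable φ ∧ (k < M.N → ∀ z,
      M.continuation k (M.dp (k + 1)) z (φ z) =
        ⨅ v, M.continuation k (M.dp (k + 1)) z v) := by
    intro k
    by_cases hk : k < M.N
    · obtain ⟨φ, h1, h2⟩ := hM.exists_measurable_optimal_rate hk
      exact ⟨φ, h1, fun _ => h2⟩
    · exact ⟨fun _ => 0, measurable_const, fun h => absurd h hk⟩
  choose φ hφm hφ using hφ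
  -- The feedback rate depends on the state and the state on past rates, so the closed-loop state is
  -- built first, by recursion, held at `(q, Z)` until time `n`.
  let z : ℕ → Ω → ℝ × ℝ := fun k => Nat.rec (fun _ => (q, Z)) (fun k zk ω =>
    if k < n then (q, Z) else M.nextState k (zk ω) (φ k (zk ω)) (M.ε (k + 1) ω)) k
  have hz_succ : ∀ k ω, z (k + 1) ω = if k < n then (q, Z) else
    M.nextState k (z k ω) (φ k (z k ω)) (M.ε (k + 1) ω) := fun _ _ => rfl
  have hz_le : ∀ k ω, k ≤ n → z k ω = (q, Z) := by
    intro k ω hk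
    cases k with
    | zero => rfl
    | succ k => rw [hz_succ, if_pos (Nat.lt_of_succ_le hk)]
  let v : ℕ → Ω → ℝ := fun k ω => φ k (z k ω)
  have hz : ∀ k, n ≤ k → ∀ ω, z k ω = M.state n q Z v k ω := by
    intro k hk
    induction k, hk using Nat.le_induction with
    | base => exact fun ω => by rw [hz_le n ω le_rfl, state_self M hn]
    | succ k hnk ih =>
      intro ω
      rw [hz_succ, if_neg hnk.not_gt, state_succ M hn hnk, ← ih ω]
  have hzm : ∀ k, k ≤ M.N → Measurable[M.ℱ k] (z k) := by
    intro k
    induction k with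
    | zero => exact fun _ => measurable_const
    | succ k ih =>
      intro hk
      have h1 := (ih (by omega)).mono (M.ℱ.mono (Nat.le_succ k)) le_rfl
      by_cases hkn : k < n
      · have : z (k + 1) = fun _ => (q, Z) := funext fun ω => by rw [hz_succ, if_pos hkn]
        rw [this]
        exact measurable_const
      · have : z (k + 1) = fun ω => M.nextState k (z k ω) (φ k (z k ω)) (M.ε (k + 1) ω) :=
          funext fun ω => by rw [hz_succ, if_neg hkn]
        rw [this]
        exact (continuous_nextState k).measurable.comp
          ((h1.prodMk ((hφm k).comp h1)).prodMk (hM.ε_measurable _ (Nat.le_add_left 1 k) hk))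
  -- The delivery region; `τ` will be its first entry time from `n` on, with `N` as the fallback
  -- date.
  let D : ℕ → Set (ℝ × ℝ) := fun k => {x | k = M.N ∨ k ∈ M.𝒩 ∧ M.dp k x = M.penalty x.1}
  have hDm : ∀ k, k ≤ M.N → MeasurableSet (D k) := fun k hk => by
    have h1 : MeasurableSet {x : ℝ × ℝ | M.dp k x = M.penalty x.1} :=
      measurableSet_eq_fun (hM.dp_regular hk).1.measurable
        (hM.lowerSemicontinuous_penalty.measurable.comp measurable_fst)
    exact (MeasurableSet.const _).union ((MeasurableSet.const _).inter h1)
  have hex : ∀ ω, ∃ k, (n ≤ k ∧ z k ω ∈ D k) ∧ ∀ m < k, ¬ (n ≤ m ∧ z m ω ∈ D m) := fun ω => by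
    have h : ∃ k, n ≤ k ∧ z k ω ∈ D k := ⟨M.N, hnN, Or.inl rfl⟩
    exact ⟨Nat.find h, Nat.find_spec h, fun m hm => Nat.find_min h hm⟩
  choose τ hτ hτ_min using hex
  let s : M.Strategy n :=
    { v := v
      τ := τ
      adapted := fun k _ hk => (hφm k).comp (hzm k hk.le)
      isStoppingTime := fun i => by
        have h1 : {ω | (τ ω : WithTop ℕ) ≤ (i : ℕ)} =
            ⋃ m ∈ Finset.range (i + 1), {ω | n ≤ m ∧ z m ω ∈ D m} := by
          ext ω
          simp only [mem_ofPred_eq, Nat.cast_le, mem_iUnion, Finset.mem_range, Nat.lt_succ_iff,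
            exists_prop]
          refine ⟨fun h => ⟨τ ω, h, hτ ω⟩, fun ⟨m, hm, h⟩ => ?_⟩
          by_contra hlt
          exact hτ_min ω m (hm.trans_lt (not_le.1 hlt)) h
        refine h1 ▸ Finset.measurableSet_biUnion _ fun m hm => ?_
        by_cases hmN : m ≤ M.N
        · exact (MeasurableSet.const _).inter (M.ℱ.mono (Nat.lt_succ_iff.1 (Finset.mem_range.1 hm))
            _ (hzm m hmN (hDm m hmN)))
        -- Beyond `N` the delivery region is empty, so no measurability of `z m` is required there.
        · have h2 : {ω | n ≤ m ∧ z m ω ∈ D m} = ∅ := by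
            refine eq_empty_of_forall_notMem fun ω hω => ?_
            rcases hω.2 with h | h
            · omega
            · have := hM.dates_subset m h.1
              omega
          rw [h2]
          exact @MeasurableSet.empty _ (M.ℱ i)
      mem_dates := fun ω => by
        rcases (hτ ω).2 with h | h
        · rw [h]
          exact Finset.mem_insert_self _ _
        · exact Finset.mem_insert_of_mem h.1
      le_τ := fun ω => (hτ ω).1 }
  refine ⟨s, hM.reducedCost_eq_dp hn hnN q Z s (fun k ω hnk hk hlt => ?_) fun k ω hk he => ?_⟩
  -- Before `τ` the state is outside the delivery region, so on a date of `𝒩` the minimum in the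
  -- recursion must be the continuation value.
  · have h1 : ¬ (n ≤ k ∧ z k ω ∈ D k) := hτ_min ω k hlt
    have h2 : ¬ (k ∈ M.𝒩 ∧ M.dp k (z k ω) = M.penalty (z k ω).1) :=
      fun h => h1 ⟨hnk, Or.inr h⟩
    change M.dp k (M.state n q Z v k ω) =
      M.continuation k (M.dp (k + 1)) (M.state n q Z v k ω) (φ k (z k ω))
    rw [← hz k hnk ω, hφ k hk]
    by_cases hk' : k ∈ M.𝒩
    · have h3 : M.dp k (z k ω) ≠ M.penalty (z k ω).1 := fun h => h2 ⟨hk', h⟩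
      rw [dp_of_lt M hk, if_pos hk'] at h3 ⊢
      exact (min_choice _ _).resolve_right h3
    · rw [dp_of_lt M hk, if_neg hk']
  · have h1 : n ≤ k ∧ z k ω ∈ D k := he ▸ hτ ω
    change M.dp k (M.state n q Z v k ω) = M.penalty (M.state n q Z v k ω).1
    rw [← hz k h1.1 ω]
    rcases h1.2 with h | h
    · omega
    · exact h.2

theorem StandingAssumptions.iInf_reducedCost {n : ℕ} (hn : 1 ≤ n) (hnN : n ≤ M.N) (q Z : ℝ) :
    ⨅ s : M.Strategy n, M.reducedCost n q Z s = M.dp n (q, Z) := by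
  obtain ⟨s, hs⟩ := hM.exists_reducedCost_eq_dp hn hnN q Z
  exact le_antisymm ((iInf_le _ s).trans hs.le)
    (le_iInf fun s => hM.dp_le_reducedCost hn hnN q Z s)

end Verification
end Model
end ASR

namespace ASR
open scoped Topology
-- Passage between the exponential and the logarithmic scale.
section LogExp

/-- The certainty equivalent `x ↦ (1 / γ) log x`, as an order isomorphism. -/
noncomputable def certaintyEquivalent (γ : ℝ) (hγ : 0 < γ) : ℝ≥0∞ ≃o EReal :=
  (ENNReal.orderIsoRpow (1 / γ) (by positivity)).trans ENNReal.logOrderIso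

theorem certaintyEquivalent_apply {γ : ℝ} (hγ : 0 < γ) (x : ℝ≥0∞) :
    certaintyEquivalent γ hγ x = ((1 / γ : ℝ) : EReal) * ENNReal.log x := by
  simp [certaintyEquivalent, ENNReal.log_rpow]

theorem exp_mul_certaintyEquivalent {γ : ℝ} (hγ : 0 < γ) (x : ℝ≥0∞) :
    EReal.exp ((γ : EReal) * certaintyEquivalent γ hγ x) = x := by
  rw [mul_comm, EReal.exp_mul]
  simp [certaintyEquivalent, ← ENNReal.rpow_mul, hγ.ne']

theorem certaintyEquivalent_exp_mul {γ : ℝ} (hγ : 0 < γ) (y : EReal) :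
    certaintyEquivalent γ hγ (EReal.exp ((γ : EReal) * y)) = y := by
  obtain ⟨x, rfl⟩ := (certaintyEquivalent γ hγ).surjective y
  rw [exp_mul_certaintyEquivalent]

theorem exp_mul_coe_add {γ : ℝ} (hγ : 0 < γ) (r : ℝ) (y : EReal) :
    EReal.exp ((γ : EReal) * ((r : EReal) + y)) =
      ENNReal.ofReal (Real.exp (γ * r)) * EReal.exp ((γ : EReal) * y) := by
  rw [mul_comm (γ : EReal), EReal.exp_mul, EReal.exp_add, ENNReal.mul_rpow_of_nonneg _ _ hγ.le,
    ← EReal.exp_mul, ← EReal.exp_mul, mul_comm y, ← EReal.coe_mul, EReal.exp_coe, mul_comm r]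

theorem exp_neg_mul_coe_sub {γ : ℝ} (hγ : 0 < γ) (r : ℝ) (y : EReal) :
    EReal.exp (-(γ : EReal) * ((r : EReal) - y)) =
      ENNReal.ofReal (Real.exp (γ * -r)) * EReal.exp ((γ : EReal) * y) := by
  rw [← exp_mul_coe_add hγ, EReal.neg_mul, ← mul_neg, EReal.neg_sub (by simp) (by simp),
    EReal.coe_neg]

end LogExp

/-! ### Reduction of the five-variable problem to the state `(q, Z)`. -/

namespace Model

variable {Ω : Type*} [mΩ : MeasurableSpace Ω] (M : Model Ω)

/-- Telescoping: as `Z_{j+1} = j/(j+1) (Z_j + ε_{j+1})`, each summand is `Z_j + ε_{j+1} - Z_{j+1}`.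
-/
theorem sum_spread_add_div {n k : ℕ} (hn : 1 ≤ n) (hk : n ≤ k) (Z : ℝ) (ω : Ω) :
    ∑ j ∈ Finset.Ico n k, (M.spread n Z j ω + M.ε (j + 1) ω) / ((j : ℝ) + 1) =
      ∑ j ∈ Finset.Ico n k, M.ε (j + 1) ω + Z - M.spread n Z k ω := by
  induction k, hk using Nat.le_induction with
  | base => simp [spread_self M hn]
  | succ k hk ih =>
    rw [Finset.sum_Ico_succ_top hk, Finset.sum_Ico_succ_top hk, ih, spread_succ M hn hk]
    have : (k : ℝ) + 1 ≠ 0 := by positivity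
    field_simp
    ring

/-- This removes the anticipation: the left side weights past innovations by the delivery date `k`,
while the right side is a sum of terms that do not refer to it. -/
theorem runningCost_eq {n k : ℕ} (hn : 1 ≤ n) (hk : n ≤ k) (q Z : ℝ) (v : ℕ → Ω → ℝ) {ω : Ω}
    (hV : ∀ j ∈ Finset.Ico n k, M.V (j + 1) ω = M.meanVolume (j + 1)) :
    M.σ * √M.δt * ((∑ j ∈ Finset.Ico n k,
        (M.inventory n q v j ω - (1 - (j : ℝ) / k) * M.Q) * M.ε (j + 1) ω)
          - (1 - (n : ℝ) / k) * M.Q * Z) + M.execCost n v k ω =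
      M.runningCost n q Z v k ω := by
  have hk0 : (k : ℝ) ≠ 0 := by
    have := hn.trans hk
    positivity
  have h1 : M.runningCost n q Z v k ω = M.σ * √M.δt * (∑ j ∈ Finset.Ico n k,
      M.inventory n q v j ω * M.ε (j + 1) ω - M.Q * ∑ j ∈ Finset.Ico n k,
        (M.spread n Z j ω + M.ε (j + 1) ω) / ((j : ℝ) + 1)) + M.execCost n v k ω := by
    rw [Finset.mul_sum, ← Finset.sum_sub_distrib, Finset.mul_sum, execCost,
      ← Finset.sum_add_distrib]
    refine Finset.sum_congr rfl fun j hj => ?_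
    simp only [stepCost, state, hV j hj]
    ring
  have h2 : ∑ j ∈ Finset.Ico n k,
      (M.inventory n q v j ω - (1 - (j : ℝ) / k) * M.Q) * M.ε (j + 1) ω =
      ∑ j ∈ Finset.Ico n k, M.inventory n q v j ω * M.ε (j + 1) ω
        - M.Q * (∑ j ∈ Finset.Ico n k, M.ε (j + 1) ω
          - (∑ j ∈ Finset.Ico n k, (j : ℝ) * M.ε (j + 1) ω) / k) := by
    rw [Finset.sum_div, ← Finset.sum_sub_distrib, Finset.mul_sum, ← Finset.sum_sub_distrib]
    exact Finset.sum_congr rfl fun j _ => by ring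
  rw [h1, sum_spread_add_div M hn hk, h2, spread]
  ring

/-- The innovation `ε (j + 1)` enters the prices at times `j + 1, …, k`, which are `k - j` in
number. -/
theorem sum_price {n k : ℕ} (hk : n ≤ k) (S : ℝ) (ω : Ω) :
    ∑ j ∈ Finset.Ico n k, M.price n S (j + 1) ω = ((k : ℝ) - n) * S
      + M.σ * √M.δt * ∑ j ∈ Finset.Ico n k, ((k : ℝ) - j) * M.ε (j + 1) ω := by
  induction k, hk using Nat.le_induction with
  | base => simp
  | succ k hk ih =>
    have h1 : ∑ j ∈ Finset.Ico n (k + 1), (((k + 1 : ℕ) : ℝ) - j) * M.ε (j + 1) ω =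
        ∑ j ∈ Finset.Ico n k, ((k : ℝ) - j) * M.ε (j + 1) ω +
          ∑ j ∈ Finset.Ico n (k + 1), M.ε (j + 1) ω := by
      rw [Finset.sum_Ico_succ_top hk, Finset.sum_Ico_succ_top hk, ← add_assoc,
        ← Finset.sum_add_distrib]
      congr 1
      · refine Finset.sum_congr rfl fun j _ => ?_
        push_cast
        ring
      · push_cast
        ring
    rw [Finset.sum_Ico_succ_top hk, ih, h1, price]
    push_cast
    ring

/-- Summation by parts: shares bought at `S_{j+1}` leave the inventory at that same price, so apart
from execution costs only `q_j (S_{j+1} - S_j)` is added in each period. -/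
theorem cash_add_inventory_mul_price {n k : ℕ} (hk : n ≤ k) (x q S : ℝ) (v : ℕ → Ω → ℝ)
    (ω : Ω) : M.cash n x S v k ω + M.inventory n q v k ω * M.price n S k ω =
      x + q * S + M.σ * √M.δt * ∑ j ∈ Finset.Ico n k, M.inventory n q v j ω * M.ε (j + 1) ω
        + M.execCost n v k ω := by
  induction k, hk using Nat.le_induction with
  | base => simp [cash, inventory, price, execCost]
  | succ k hk ih =>
    simp only [cash] at ih ⊢
    have h1 : M.price n S (k + 1) ω = M.price n S k ω + M.σ * √M.δt * M.ε (k + 1) ω := by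
      rw [price, price, Finset.sum_Ico_succ_top hk]
      ring
    have h2 : M.inventory n q v (k + 1) ω = M.inventory n q v k ω - v k ω * M.δt := by
      rw [inventory, inventory, Finset.sum_Ico_succ_top hk]
      ring
    rw [Finset.sum_Ico_succ_top hk, Finset.sum_Ico_succ_top hk, h1, h2]
    linear_combination ih

/-- The change of variables from the five-dimensional to the reduced problem. -/
theorem neg_payoff_eq {n k : ℕ} (hn : 1 ≤ n) (hk : n ≤ k) (hc : M.σ * √M.δt ≠ 0)
    (x q S A : ℝ) (v : ℕ → Ω → ℝ) (ω : Ω) :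
    -(M.Q * M.average n A S k ω - M.cash n x S v k ω
        - M.inventory n q v k ω * M.price n S k ω) =
      (-M.Q * A + x + q * S) + (M.σ * √M.δt * ((∑ j ∈ Finset.Ico n k,
        (M.inventory n q v j ω - (1 - (j : ℝ) / k) * M.Q) * M.ε (j + 1) ω)
          - (1 - (n : ℝ) / k) * M.Q * ((S - A) / (M.σ * √M.δt))) + M.execCost n v k ω) := by
  have hk0 : (k : ℝ) ≠ 0 := by
    have := hn.trans hk
    positivity
  have h1 := cash_add_inventory_mul_price M hk x q S v ω
  have h2 : M.average n A S k ω = n / k * A + (1 - n / k) * S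
      + M.σ * √M.δt * ∑ j ∈ Finset.Ico n k, (1 - (j : ℝ) / k) * M.ε (j + 1) ω := by
    have h3 : ∑ j ∈ Finset.Ico n k, (1 - (j : ℝ) / k) * M.ε (j + 1) ω =
        1 / k * ∑ j ∈ Finset.Ico n k, ((k : ℝ) - j) * M.ε (j + 1) ω := by
      rw [Finset.mul_sum]
      refine Finset.sum_congr rfl fun j _ => ?_
      field_simp
    rw [average, sum_price M hk, h3]
    field_simp
    ring
  have h4 : ∑ j ∈ Finset.Ico n k,
      (M.inventory n q v j ω - (1 - (j : ℝ) / k) * M.Q) * M.ε (j + 1) ω =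
      ∑ j ∈ Finset.Ico n k, M.inventory n q v j ω * M.ε (j + 1) ω
        - M.Q * ∑ j ∈ Finset.Ico n k, (1 - (j : ℝ) / k) * M.ε (j + 1) ω := by
    rw [Finset.mul_sum, ← Finset.sum_sub_distrib]
    exact Finset.sum_congr rfl fun j _ => by ring
  have h5 : M.σ * √M.δt * ((1 - (n : ℝ) / k) * M.Q * ((S - A) / (M.σ * √M.δt))) =
      (1 - (n : ℝ) / k) * M.Q * (S - A) := by
    rw [mul_left_comm, mul_div_cancel₀ _ hc]
  rw [h2, h4, mul_sub, h5]
  linear_combination h1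

variable {M} (hM : M.StandingAssumptions)

include hM

theorem StandingAssumptions.volume_ae_eq_all :
    ∀ᵐ ω ∂M.P, ∀ k < M.N, M.V (k + 1) ω = M.meanVolume (k + 1) := by
  rw [ae_all_iff]
  intro k
  by_cases hk : k < M.N
  · filter_upwards [(hM.volume_ae_eq (Nat.le_add_left 1 k) hk).2] with ω hω _ using hω
  · exact Eventually.of_forall fun ω h => absurd h hk

theorem StandingAssumptions.lintegral_exp_eq_reducedCost {n : ℕ} (hn : 1 ≤ n) (q Z : ℝ)
    (s : M.Strategy n) :
    ∫⁻ ω, EReal.exp ((M.γ : EReal) *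
      (((M.σ * √M.δt *
            ((∑ j ∈ Finset.Ico n (s.τ ω),
                (M.inventory n q s.v j ω - (1 - (j : ℝ) / s.τ ω) * M.Q) * M.ε (j + 1) ω)
              - (1 - (n : ℝ) / s.τ ω) * M.Q * Z)
          + M.execCost n s.v (s.τ ω) ω : ℝ) : EReal)
        + (M.ℓ (M.inventory n q s.v (s.τ ω) ω) : EReal))) ∂M.P = M.reducedCost n q Z s := by
  refine lintegral_congr_ae ?_
  filter_upwards [hM.volume_ae_eq_all] with ω hω
  rw [exp_mul_coe_add hM.γ_pos, runningCost_eq M hn (s.le_τ ω) q Z s.v fun j hj =>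
    hω j ((Finset.mem_Ico.1 hj).2.trans_le (s.τ_le hM ω))]
  rfl

theorem StandingAssumptions.θ_eq {n : ℕ} (hn : 1 ≤ n) (hnN : n ≤ M.N) (q Z : ℝ) :
    M.θ n q Z = certaintyEquivalent M.γ hM.γ_pos (M.dp n (q, Z)) := by
  rw [← hM.iInf_reducedCost hn hnN, OrderIso.map_iInf]
  simp only [certaintyEquivalent_apply]
  refine iInf_congr fun s => ?_
  rw [← hM.lintegral_exp_eq_reducedCost hn]

theorem StandingAssumptions.exp_mul_θ {n : ℕ} (hn : 1 ≤ n) (hnN : n ≤ M.N) (q Z : ℝ) :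
    EReal.exp ((M.γ : EReal) * M.θ n q Z) = M.dp n (q, Z) := by
  rw [hM.θ_eq hn hnN, exp_mul_certaintyEquivalent]

theorem StandingAssumptions.θtilde_eq {n : ℕ} (hnN : n < M.N) (q Z : ℝ) :
    M.θtilde n q Z = certaintyEquivalent M.γ hM.γ_pos
      (⨅ v, M.continuation n (M.dp (n + 1)) (q, Z) v) := by
  rw [OrderIso.map_iInf, θtilde]
  refine iInf_congr fun v => ?_
  rw [certaintyEquivalent_apply]
  congr 2
  have hm : Measurable fun e => ENNReal.ofReal (Real.exp (M.γ * M.stepCost n (q, Z) v e)) *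
      M.dp (n + 1) (M.nextState n (q, Z) v e) :=
    hM.measurable_integrand (hM.dp_regular (k := n + 1) hnN).1 n (q, Z) v
  rw [continuation, ← hM.map_ε (Nat.le_add_left 1 n) hnN,
    lintegral_map hm (hM.measurable_ε (Nat.le_add_left 1 n) hnN)]
  refine lintegral_congr_ae ?_
  filter_upwards [hM.volume_ae_eq_all] with ω hω
  rw [exp_mul_coe_add hM.γ_pos, hM.exp_mul_θ (Nat.le_add_left 1 n) hnN, hω n hnN]
  rfl

theorem StandingAssumptions.u_eq {n : ℕ} (hn : 1 ≤ n) (hnN : n ≤ M.N) (x q S A : ℝ) :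
    M.u n x q S A = -((ENNReal.ofReal (Real.exp (M.γ * (-M.Q * A + x + q * S))) *
      M.dp n (q, (S - A) / (M.σ * √M.δt)) : ℝ≥0∞) : EReal) := by
  have hc : M.σ * √M.δt ≠ 0 := (mul_pos hM.σ_pos (Real.sqrt_pos.2 hM.δt_pos)).ne'
  have h1 : ∀ s : M.Strategy n, ∫⁻ ω, EReal.exp (-(M.γ : EReal) *
        (((M.Q * M.average n A S (s.τ ω) ω - M.cash n x S s.v (s.τ ω) ω
            - M.inventory n q s.v (s.τ ω) ω * M.price n S (s.τ ω) ω : ℝ) : EReal)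
          - (M.ℓ (M.inventory n q s.v (s.τ ω) ω) : EReal))) ∂M.P =
      ENNReal.ofReal (Real.exp (M.γ * (-M.Q * A + x + q * S))) *
        M.reducedCost n q ((S - A) / (M.σ * √M.δt)) s := fun s => by
    rw [← hM.lintegral_exp_eq_reducedCost hn, ← lintegral_const_mul' _ _ ENNReal.ofReal_ne_top]
    refine lintegral_congr fun ω => ?_
    rw [exp_neg_mul_coe_sub hM.γ_pos, exp_mul_coe_add hM.γ_pos,
      neg_payoff_eq M hn (s.le_τ ω) hc, mul_add, Real.exp_add,
      ENNReal.ofReal_mul (Real.exp_pos _).le, mul_assoc]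
  simp only [u, h1]
  -- An optimal strategy attains the supremum, so no interchange of infimum, product and negation is
  -- needed.
  obtain ⟨s, hs⟩ := hM.exists_reducedCost_eq_dp hn hnN q ((S - A) / (M.σ * √M.δt))
  refine le_antisymm (iSup_le fun s => ?_) ?_
  · rw [EReal.neg_le_neg_iff, EReal.coe_ennreal_le_coe_ennreal_iff]
    exact mul_le_mul_right (hM.dp_le_reducedCost hn hnN q _ s) _
  · rw [← hs]
    exact le_iSup (fun s : M.Strategy n =>
      -((ENNReal.ofReal (Real.exp (M.γ * (-M.Q * A + x + q * S))) *
        M.reducedCost n q ((S - A) / (M.σ * √M.δt)) s : ℝ≥0∞) : EReal)) s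

end Model

end ASR

/-! ### The proposition, read off from `dp` through the certainty equivalent. -/

theorem mainTheorem1 {Ω : Type*} [MeasurableSpace Ω] (M : ASR.Model Ω)
    (hM : M.StandingAssumptions) :
    -- (i) the change of variables, with `Y = -QA + x + qS`
    (∀ n : ℕ, 1 ≤ n → n ≤ M.N → ∀ x q S A : ℝ,
      M.u n x q S A =
        -((EReal.exp (-(M.γ : EReal) *
            (-((-M.Q * A + x + q * S : ℝ) : EReal)
              - M.θ n q ((S - A) / (M.σ * √M.δt)))) : ℝ≥0∞) : EReal)) ∧
    -- (ii) the Bellman equation in three variables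
    (∀ n : ℕ, 1 ≤ n → n ≤ M.N → ∀ q Z : ℝ,
      M.θ n q Z =
        if n = M.N then (M.ℓ q : EReal)
        else if n ∈ M.𝒩 then min (M.θtilde n q Z) (M.ℓ q : EReal)
        else M.θtilde n q Z) ∧
    -- finiteness: always from below, and from above if all exponential moments are finite
    (∀ n : ℕ, 1 ≤ n → n ≤ M.N → ∀ q Z : ℝ, M.θ n q Z ≠ ⊥) ∧
    ((∀ t : ℝ, Integrable (fun ω => Real.exp (t * M.ε 1 ω)) M.P) →
      ∀ n : ℕ, 1 ≤ n → n < M.N → ∀ q Z : ℝ, M.θ n q Z ≠ ⊤) := by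
  refine ⟨fun n hn hnN x q S A => ?_, fun n hn hnN q Z => ?_, fun n hn hnN q Z => ?_,
    fun hexp n hn hnN q Z => ?_⟩
  · rw [hM.u_eq hn hnN, ← EReal.coe_neg (-M.Q * A + x + q * S), ASR.exp_neg_mul_coe_sub hM.γ_pos, hM.exp_mul_θ hn hnN,
      neg_neg]
  · have hpen : ASR.certaintyEquivalent M.γ hM.γ_pos (M.penalty q) = (M.ℓ q : EReal) :=
      ASR.certaintyEquivalent_exp_mul hM.γ_pos _
    rw [hM.θ_eq hn hnN]
    rcases hnN.eq_or_lt with rfl | hlt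
    · rw [if_pos rfl, M.dp_terminal, hpen]
    · rw [if_neg hlt.ne, M.dp_of_lt hlt, hM.θtilde_eq hlt, ← hpen]
      split_ifs
      · exact OrderIso.map_inf _ _ _
      · rfl
  · rw [hM.θ_eq hn hnN, ASR.certaintyEquivalent, OrderIso.trans_apply, Ne,
      ENNReal.logOrderIso_apply, ENNReal.log_eq_bot_iff]
    simpa [hM.γ_pos.le, hM.γ_pos.not_gt] using fun h => absurd h (hM.dp_ne_zero hnN (q, Z))
  -- An order isomorphism sends only `∞` to `⊤`, so finiteness of `θ` from above is that of `dp`.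
  · rw [← (ASR.certaintyEquivalent M.γ hM.γ_pos).map_top, hM.θ_eq hn hnN.le]
    exact fun h => hM.dp_ne_top hexp hnN _ ((OrderIso.injective _) h)
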